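/- **Setting.** Let $\mathcal X_1,\mathcal X_2,\mathcal W,\mathcal Y,\tilde{\mathcal X}_1,\tilde{\mathcal X}_2,\tilde{\mathcal Y},\tilde{\mathcal Z}$ be finite alphabets, let $q=q_{X_1X_2WY}$ be a p.m.f. on $\mathcal X_1\times\mathcal X_2\times\mathcal W\times\mathcal Y$ (the target) with marginal $q_{X_1X_2W}$, and let $p(\tilde y,\tilde z|\tilde x_1,\tilde x_2)$ be a discrete memoryless channel. All logarithms are to base $2$, and $\|p-p'\|_1=\frac12\sum_x|p(x)-p'(x)|$. For $R_{01},R_{02}\ge 0$, a $(2^{nR_{01}},2^{nR_{02}},n)$ code consists of two randomized encoders $p^{\mathrm{Enc}_j}(\tilde x_j^n|x_j^n,k_j)$, $j=1,2$, and a randomized decoder $p^{\mathrm{Dec}}(y^n|k_1,k_2,w^n,\tilde y^n)$, where $k_j\in[1:2^{nR_{0j}}]=\{1,\dots,\lfloor 2^{nR_{0j}}\rfloor\}$. It induces a joint p.m.f. in which $(X_{1i},X_{2i},W_i)_{i\le n}$ are i.i.d. $\sim q_{X_1X_2W}$, the indices $K_1,K_2$ are uniform, independent of each other and of the sources, the encoders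 generate $\tilde X_j^n$ from $(X_j^n,K_j)$, $n$ uses of the memoryless channel generate $(\tilde Y^n,\tilde Z^n)$, and the decoder generates $Y^n$ from $(K_1,K_2,W^n,\tilde Y^n)$. The pair $(R_{01},R_{02})$ is achievable (with secrecy) if there is a sequence of such codes with $$\lim_{n\to\infty}\bigl\|p_{X_1^n,X_2^n,W^n,Y^n,\tilde Z^n}-p_{\tilde Z^n}\cdot q^{(n)}_{X_1X_2WY}\bigr\|_1=0,\qquad q^{(n)}_{X_1X_2WY}=\prod_{i=1}^n q_{X_1X_2WY}(x_{1i},x_{2i},w_i,y_i).$$ The rate region $\mathcal R$ is the closure of the set of achievable pairs. **Theorem (Outer bound).** Let $(R_{01},R_{02})\in\mathcal R$. Then for every $\epsilon\in(0,\frac14]$ there exist finite alphabets for auxiliary variables $T,U_1,U_2$ and a p.m.f. of the form $$p(x_1,x_2,w,t,u_1,u_2,\tilde x_1,\tilde x_2,\tilde y,\tilde z,y)=q(x_1,x_2,w)\,p(t)\,p(u_1,u_2|x_1,x_2,t)\,p(\tilde x_1,\tilde x_2|t)\,p(\tilde y,\tilde z|\tilde x_1,\tilde x_2)\,p(y|u_1,u_2,w,t)$$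 with $\|p(x_1,x_2,w,y|t)-q(x_1,x_2,w,y)\|_1\le\epsilon$ for all $t$, such that \begin{align*} I(\tilde X_1;\tilde Y|\tilde X_2,T)&\ge I(U_1;X_1|U_2,X_2,W,T)\\ I(\tilde X_2;\tilde Y|\tilde X_1,T)&\ge I(U_2;X_2|U_1,X_1,W,T)\\ I(\tilde X_1,\tilde X_2;\tilde Y|T)&\ge I(U_1,U_2;X_1,X_2|W,T)\\ R_{01}+R_{02}&\ge I(U_1,U_2;X_1,X_2,Y|W,T)-H(Y|X_1,X_2,W,T)-I(\tilde X_1,\tilde X_2;\tilde Y|\tilde Z,T)-2g(\epsilon)\\ R_{01}&\ge I(U_1;X_1,X_2,Y|W,T)-H(Y|X_1,X_2,W,T)-I(\tilde X_1,\tilde X_2;\tilde Y|\tilde Z,T)-2g(\epsilon)\\ R_{02}&\ge I(U_2;X_1,X_2,Y|W,T)-H(Y|X_1,X_2,W,T)-I(\tilde X_1,\tilde X_2;\tilde Y|\tilde Z,T)-2g(\epsilon), \end{align*} where $$g(\epsilon)=2\sqrt\epsilon\Bigl(H_q(X_1,X_2,W,Y)+\log\frac{|\mathcal X_1||\mathcal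 X_2||\mathcal W||\mathcal Y||\tilde{\mathcal Z}|}{\epsilon}\Bigr).$$ -/

import Mathlib

open Filter Topology
open scoped BigOperators

namespace Coordination

noncomputable section

/-! ## Probability mass functions, entropy and information on finite alphabets

A p.m.f. on a finite alphabet `α` is an element of `stdSimplex ℝ α`. All logarithms are to base 2,
in accordance with the index sets of size `2 ^ (n R)`. -/

/-- The total variation distance `½ ∑ |p - q|`. -/
def tv {α : Type*} [Fintype α] (p q : α → ℝ) : ℝ := (1 / 2) * ∑ a, |p a - q a|

open Classical in
/-- The law of the random variable `X` on the finite sample space `Ω` with p.m.f. `p`. -/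
def law {Ω α : Type*} [Fintype Ω] (p : Ω → ℝ) (X : Ω → α) (a : α) : ℝ :=
  ∑ ω, if X ω = a then p ω else 0

/-- The entropy of a p.m.f., in bits. -/
def pmfEntropy {α : Type*} [Fintype α] (p : α → ℝ) : ℝ := -∑ a, p a * Real.logb 2 (p a)

/-- The conditional entropy `H(X | Z) = -∑ p(x, z) log p(x | z)`. -/
def condEntropy {Ω α γ : Type*} [Fintype Ω] [Fintype α] [Fintype γ]
    (p : Ω → ℝ) (X : Ω → α) (Z : Ω → γ) : ℝ :=
  -∑ x, ∑ z, law p (fun ω => (X ω, Z ω)) (x, z) *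
    Real.logb 2 (law p (fun ω => (X ω, Z ω)) (x, z) / law p Z z)

/-- The conditional mutual information `I(X; Y | Z) = H(X | Z) - H(X | Y, Z)`. -/
def condMI {Ω α β γ : Type*} [Fintype Ω] [Fintype α] [Fintype β] [Fintype γ]
    (p : Ω → ℝ) (X : Ω → α) (Y : Ω → β) (Z : Ω → γ) : ℝ :=
  condEntropy p X Z - condEntropy p X (fun ω => (Y ω, Z ω))

/-! ## The coordination problem

`𝓧₁`, `𝓧₂`: sources of the encoders; `𝓦`: side information of the decoder; `𝓨`: simulated output;
`𝓐₁`, `𝓐₂`: channel inputs; `𝓑`: channel output at the legitimate receiver; `𝓩`: channel output at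
the eavesdropper. -/

/-- The marginal `q(x₁, x₂, w)` of the target p.m.f. -/
def source {𝓧₁ 𝓧₂ 𝓦 𝓨 : Type*} [Fintype 𝓨] (q : 𝓧₁ × 𝓧₂ × 𝓦 × 𝓨 → ℝ)
    (x₁ : 𝓧₁) (x₂ : 𝓧₂) (w : 𝓦) : ℝ := ∑ y, q (x₁, x₂, w, y)

/-- A code of blocklength `n` with pairwise shared randomness alphabets of sizes `M₁` and `M₂`:
two randomized encoders and a randomized decoder. -/
structure Code (𝓧₁ 𝓧₂ 𝓦 𝓨 𝓐₁ 𝓐₂ 𝓑 : Type*) [Fintype 𝓨] [Fintype 𝓐₁] [Fintype 𝓐₂]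
    (M₁ M₂ n : ℕ) where
  /-- `p^{Enc₁}(a₁ⁿ | x₁ⁿ, k₁)` -/
  enc₁ : (Fin n → 𝓧₁) → Fin M₁ → (Fin n → 𝓐₁) → ℝ
  /-- `p^{Enc₂}(a₂ⁿ | x₂ⁿ, k₂)` -/
  enc₂ : (Fin n → 𝓧₂) → Fin M₂ → (Fin n → 𝓐₂) → ℝ
  /-- `p^{Dec}(yⁿ | k₁, k₂, wⁿ, bⁿ)` -/
  dec : Fin M₁ → Fin M₂ → (Fin n → 𝓦) → (Fin n → 𝓑) → (Fin n → 𝓨) → ℝ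
  enc₁_mem : ∀ x k, enc₁ x k ∈ stdSimplex ℝ (Fin n → 𝓐₁)
  enc₂_mem : ∀ x k, enc₂ x k ∈ stdSimplex ℝ (Fin n → 𝓐₂)
  dec_mem : ∀ k₁ k₂ w b, dec k₁ k₂ w b ∈ stdSimplex ℝ (Fin n → 𝓨)

section Code

variable {𝓧₁ 𝓧₂ 𝓦 𝓨 𝓐₁ 𝓐₂ 𝓑 𝓩 : Type*} [Fintype 𝓧₁] [Fintype 𝓧₂] [Fintype 𝓦] [Fintype 𝓨]
  [Fintype 𝓐₁] [Fintype 𝓐₂] [Fintype 𝓑] [Fintype 𝓩] {M₁ M₂ n : ℕ}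

/-- The joint p.m.f. of all random variables induced by a code, for i.i.d. sources, independent
uniform shared randomness, and the memoryless channel `ch (a₁, a₂) (b, z) = p(b, z | a₁, a₂)`. -/
def Code.joint (c : Code 𝓧₁ 𝓧₂ 𝓦 𝓨 𝓐₁ 𝓐₂ 𝓑 M₁ M₂ n)
    (q : 𝓧₁ × 𝓧₂ × 𝓦 × 𝓨 → ℝ) (ch : 𝓐₁ × 𝓐₂ → 𝓑 × 𝓩 → ℝ)
    (x₁ : Fin n → 𝓧₁) (x₂ : Fin n → 𝓧₂) (w : Fin n → 𝓦) (k₁ : Fin M₁) (k₂ : Fin M₂)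
    (a₁ : Fin n → 𝓐₁) (a₂ : Fin n → 𝓐₂) (b : Fin n → 𝓑) (z : Fin n → 𝓩) (y : Fin n → 𝓨) : ℝ :=
  1 / ((M₁ : ℝ) * (M₂ : ℝ)) * (∏ i, source q (x₁ i) (x₂ i) (w i)) * c.enc₁ x₁ k₁ a₁ * c.enc₂ x₂ k₂ a₂
    * (∏ i, ch (a₁ i, a₂ i) (b i, z i)) * c.dec k₁ k₂ w b y

/-- The induced marginal on `(X₁ⁿ, X₂ⁿ, Wⁿ, Yⁿ, Zⁿ)`. -/
def Code.induced (c : Code 𝓧₁ 𝓧₂ 𝓦 𝓨 𝓐₁ 𝓐₂ 𝓑 M₁ M₂ n)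
    (q : 𝓧₁ × 𝓧₂ × 𝓦 × 𝓨 → ℝ) (ch : 𝓐₁ × 𝓐₂ → 𝓑 × 𝓩 → ℝ) :
    (Fin n → 𝓧₁) × (Fin n → 𝓧₂) × (Fin n → 𝓦) × (Fin n → 𝓨) × (Fin n → 𝓩) → ℝ :=
  fun (x₁, x₂, w, y, z) =>
    ∑ k₁, ∑ k₂, ∑ a₁, ∑ a₂, ∑ b, c.joint q ch x₁ x₂ w k₁ k₂ a₁ a₂ b z y

/-- The induced marginal on `Zⁿ`. -/
def Code.inducedZ (c : Code 𝓧₁ 𝓧₂ 𝓦 𝓨 𝓐₁ 𝓐₂ 𝓑 M₁ M₂ n)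
    (q : 𝓧₁ × 𝓧₂ × 𝓦 × 𝓨 → ℝ) (ch : 𝓐₁ × 𝓐₂ → 𝓑 × 𝓩 → ℝ) (z : Fin n → 𝓩) : ℝ :=
  ∑ x₁, ∑ x₂, ∑ w, ∑ y, c.induced q ch (x₁, x₂, w, y, z)

/-- The ideal p.m.f.: `Zⁿ` as induced by the code, and independent of it an i.i.d. sequence with
law `q`. -/
def Code.ideal (c : Code 𝓧₁ 𝓧₂ 𝓦 𝓨 𝓐₁ 𝓐₂ 𝓑 M₁ M₂ n)
    (q : 𝓧₁ × 𝓧₂ × 𝓦 × 𝓨 → ℝ) (ch : 𝓐₁ × 𝓐₂ → 𝓑 × 𝓩 → ℝ) :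
    (Fin n → 𝓧₁) × (Fin n → 𝓧₂) × (Fin n → 𝓦) × (Fin n → 𝓨) × (Fin n → 𝓩) → ℝ :=
  fun (x₁, x₂, w, y, z) => c.inducedZ q ch z * ∏ i, q (x₁ i, x₂ i, w i, y i)

/-- The number of integers in `[1 : 2 ^ (n R)]`. -/
def numKeys (n : ℕ) (R : ℝ) : ℕ := ⌊(2 : ℝ) ^ ((n : ℝ) * R)⌋₊

/-- `(R₀₁, R₀₂)` is achievable for the target p.m.f. `q` with secrecy over the channel `ch`. -/
def Achievable (q : 𝓧₁ × 𝓧₂ × 𝓦 × 𝓨 → ℝ) (ch : 𝓐₁ × 𝓐₂ → 𝓑 × 𝓩 → ℝ) (R : ℝ × ℝ) : Prop :=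
  0 ≤ R.1 ∧ 0 ≤ R.2 ∧
    ∃ c : ∀ n : ℕ, Code 𝓧₁ 𝓧₂ 𝓦 𝓨 𝓐₁ 𝓐₂ 𝓑 (numKeys n R.1) (numKeys n R.2) n,
      Tendsto (fun n => tv ((c n).induced q ch) ((c n).ideal q ch)) atTop (𝓝 0)

/-- The rate region: the closure of the set of achievable rate pairs. -/
def rateRegion (q : 𝓧₁ × 𝓧₂ × 𝓦 × 𝓨 → ℝ) (ch : 𝓐₁ × 𝓐₂ → 𝓑 × 𝓩 → ℝ) : Set (ℝ × ℝ) :=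
  closure {R | Achievable q ch R}

/-- `g(ε) = 2 √ε (H_q(X₁, X₂, W, Y) + log (|𝓧₁| |𝓧₂| |𝓦| |𝓨| |𝓩| / ε))`. -/
def slack (𝓩 : Type*) [Fintype 𝓩] (q : 𝓧₁ × 𝓧₂ × 𝓦 × 𝓨 → ℝ) (ε : ℝ) : ℝ :=
  2 * √ε * (pmfEntropy q + Real.logb 2 (((Fintype.card 𝓧₁ : ℝ) * Fintype.card 𝓧₂ *
    Fintype.card 𝓦 * Fintype.card 𝓨 * Fintype.card 𝓩) / ε))

end Code

/-! ## The single-letter p.m.f.s of the outer bound -/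

/-- The factors `p(t)`, `p(u₁, u₂ | x₁, x₂, t)`, `p(a₁, a₂ | t)` and `p(y | u₁, u₂, w, t)`. -/
structure Auxiliary (𝓧₁ 𝓧₂ 𝓦 𝓨 𝓐₁ 𝓐₂ 𝓣 𝓤₁ 𝓤₂ : Type*) [Fintype 𝓨] [Fintype 𝓐₁] [Fintype 𝓐₂]
    [Fintype 𝓣] [Fintype 𝓤₁] [Fintype 𝓤₂] where
  pT : 𝓣 → ℝ
  pU : 𝓧₁ → 𝓧₂ → 𝓣 → 𝓤₁ × 𝓤₂ → ℝ
  pA : 𝓣 → 𝓐₁ × 𝓐₂ → ℝ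
  pY : 𝓤₁ → 𝓤₂ → 𝓦 → 𝓣 → 𝓨 → ℝ
  pT_mem : pT ∈ stdSimplex ℝ 𝓣
  pU_mem : ∀ x₁ x₂ t, pU x₁ x₂ t ∈ stdSimplex ℝ (𝓤₁ × 𝓤₂)
  pA_mem : ∀ t, pA t ∈ stdSimplex ℝ (𝓐₁ × 𝓐₂)
  pY_mem : ∀ u₁ u₂ w t, pY u₁ u₂ w t ∈ stdSimplex ℝ 𝓨

/-- The values of `(X₁, X₂, W, T, U₁, U₂, A₁, A₂, B, Z, Y)`. -/
abbrev Sample (𝓧₁ 𝓧₂ 𝓦 𝓣 𝓤₁ 𝓤₂ 𝓐₁ 𝓐₂ 𝓑 𝓩 𝓨 : Type*) : Type _ :=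
  𝓧₁ × 𝓧₂ × 𝓦 × 𝓣 × 𝓤₁ × 𝓤₂ × 𝓐₁ × 𝓐₂ × 𝓑 × 𝓩 × 𝓨

section Auxiliary

variable {𝓧₁ 𝓧₂ 𝓦 𝓨 𝓐₁ 𝓐₂ 𝓑 𝓩 𝓣 𝓤₁ 𝓤₂ : Type*} [Fintype 𝓨] [Fintype 𝓐₁] [Fintype 𝓐₂]
  [Fintype 𝓣] [Fintype 𝓤₁] [Fintype 𝓤₂]

/-- The conditional p.m.f. of all the other variables given `T = t`:
`q(x₁, x₂, w) p(u₁, u₂ | x₁, x₂, t) p(a₁, a₂ | t) p(b, z | a₁, a₂) p(y | u₁, u₂, w, t)`. -/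
def Auxiliary.givenT (P : Auxiliary 𝓧₁ 𝓧₂ 𝓦 𝓨 𝓐₁ 𝓐₂ 𝓣 𝓤₁ 𝓤₂)
    (q : 𝓧₁ × 𝓧₂ × 𝓦 × 𝓨 → ℝ) (ch : 𝓐₁ × 𝓐₂ → 𝓑 × 𝓩 → ℝ) (t : 𝓣)
    (x₁ : 𝓧₁) (x₂ : 𝓧₂) (w : 𝓦) (u₁ : 𝓤₁) (u₂ : 𝓤₂) (a₁ : 𝓐₁) (a₂ : 𝓐₂)
    (b : 𝓑) (z : 𝓩) (y : 𝓨) : ℝ :=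
  source q x₁ x₂ w * P.pU x₁ x₂ t (u₁, u₂) * P.pA t (a₁, a₂) * ch (a₁, a₂) (b, z) *
    P.pY u₁ u₂ w t y

/-- The joint p.m.f. of all the variables. -/
def Auxiliary.joint (P : Auxiliary 𝓧₁ 𝓧₂ 𝓦 𝓨 𝓐₁ 𝓐₂ 𝓣 𝓤₁ 𝓤₂)
    (q : 𝓧₁ × 𝓧₂ × 𝓦 × 𝓨 → ℝ) (ch : 𝓐₁ × 𝓐₂ → 𝓑 × 𝓩 → ℝ) :
    Sample 𝓧₁ 𝓧₂ 𝓦 𝓣 𝓤₁ 𝓤₂ 𝓐₁ 𝓐₂ 𝓑 𝓩 𝓨 → ℝ :=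
  fun (x₁, x₂, w, t, u₁, u₂, a₁, a₂, b, z, y) =>
    P.pT t * P.givenT q ch t x₁ x₂ w u₁ u₂ a₁ a₂ b z y

/-- The conditional marginal `p(x₁, x₂, w, y | t)`. -/
def Auxiliary.targetGivenT [Fintype 𝓑] [Fintype 𝓩] (P : Auxiliary 𝓧₁ 𝓧₂ 𝓦 𝓨 𝓐₁ 𝓐₂ 𝓣 𝓤₁ 𝓤₂)
    (q : 𝓧₁ × 𝓧₂ × 𝓦 × 𝓨 → ℝ) (ch : 𝓐₁ × 𝓐₂ → 𝓑 × 𝓩 → ℝ) (t : 𝓣) :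
    𝓧₁ × 𝓧₂ × 𝓦 × 𝓨 → ℝ :=
  fun (x₁, x₂, w, y) =>
    ∑ u₁, ∑ u₂, ∑ a₁, ∑ a₂, ∑ b, ∑ z, P.givenT q ch t x₁ x₂ w u₁ u₂ a₁ a₂ b z y

end Auxiliary

/-! The coordinate random variables on `Sample`. -/

section Coordinates

variable {𝓧₁ 𝓧₂ 𝓦 𝓣 𝓤₁ 𝓤₂ 𝓐₁ 𝓐₂ 𝓑 𝓩 𝓨 : Type*}

def rvX₁ : Sample 𝓧₁ 𝓧₂ 𝓦 𝓣 𝓤₁ 𝓤₂ 𝓐₁ 𝓐₂ 𝓑 𝓩 𝓨 → 𝓧₁ := fun (x₁, _) => x₁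
def rvX₂ : Sample 𝓧₁ 𝓧₂ 𝓦 𝓣 𝓤₁ 𝓤₂ 𝓐₁ 𝓐₂ 𝓑 𝓩 𝓨 → 𝓧₂ := fun (_, x₂, _) => x₂
def rvW : Sample 𝓧₁ 𝓧₂ 𝓦 𝓣 𝓤₁ 𝓤₂ 𝓐₁ 𝓐₂ 𝓑 𝓩 𝓨 → 𝓦 := fun (_, _, w, _) => w
def rvT : Sample 𝓧₁ 𝓧₂ 𝓦 𝓣 𝓤₁ 𝓤₂ 𝓐₁ 𝓐₂ 𝓑 𝓩 𝓨 → 𝓣 := fun (_, _, _, t, _) => t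
def rvU₁ : Sample 𝓧₁ 𝓧₂ 𝓦 𝓣 𝓤₁ 𝓤₂ 𝓐₁ 𝓐₂ 𝓑 𝓩 𝓨 → 𝓤₁ := fun (_, _, _, _, u₁, _) => u₁
def rvU₂ : Sample 𝓧₁ 𝓧₂ 𝓦 𝓣 𝓤₁ 𝓤₂ 𝓐₁ 𝓐₂ 𝓑 𝓩 𝓨 → 𝓤₂ := fun (_, _, _, _, _, u₂, _) => u₂
def rvA₁ : Sample 𝓧₁ 𝓧₂ 𝓦 𝓣 𝓤₁ 𝓤₂ 𝓐₁ 𝓐₂ 𝓑 𝓩 𝓨 → 𝓐₁ := fun (_, _, _, _, _, _, a₁, _) => a₁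
def rvA₂ : Sample 𝓧₁ 𝓧₂ 𝓦 𝓣 𝓤₁ 𝓤₂ 𝓐₁ 𝓐₂ 𝓑 𝓩 𝓨 → 𝓐₂ := fun (_, _, _, _, _, _, _, a₂, _) => a₂
def rvB : Sample 𝓧₁ 𝓧₂ 𝓦 𝓣 𝓤₁ 𝓤₂ 𝓐₁ 𝓐₂ 𝓑 𝓩 𝓨 → 𝓑 := fun (_, _, _, _, _, _, _, _, b, _) => b
def rvZ : Sample 𝓧₁ 𝓧₂ 𝓦 𝓣 𝓤₁ 𝓤₂ 𝓐₁ 𝓐₂ 𝓑 𝓩 𝓨 → 𝓩 := fun (_, _, _, _, _, _, _, _, _, z, _) => z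
def rvY : Sample 𝓧₁ 𝓧₂ 𝓦 𝓣 𝓤₁ 𝓤₂ 𝓐₁ 𝓐₂ 𝓑 𝓩 𝓨 → 𝓨 := fun (_, _, _, _, _, _, _, _, _, _, y) => y

/-- The pair of two random variables. -/
def pair {Ω α β : Type*} (X : Ω → α) (Y : Ω → β) : Ω → α × β := fun ω => (X ω, Y ω)

end Coordinates

end

end Coordination

/-!
# Outer bound for coordination over a multiple-access channel with secrecy

Fix a code of blocklength `n` whose induced law is close to the ideal one, and let `S = (X₁, X₂, W)`
and `K = (K₁, K₂)`. The time-sharing variable `T` is uniform over the positions, and at position `i`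
the auxiliary variables are `Uⱼ = (Kⱼ, Bⁿ, Wⁿ without Wᵢ)`. As the encoders do not see `Wⁿ` and the
letters are i.i.d., `(U₁, U₂) - (X₁ᵢ, X₂ᵢ) - Wᵢ` is a Markov chain (`Code.hasCond_aux`); as `(U₁, U₂)`
and `Wᵢ` contain all that the decoder sees, so is `(X₁ᵢ, X₂ᵢ) - (U₁, U₂, Wᵢ) - Yᵢ`
(`Code.hasCond_out`). The channel variables are taken independent of these given `T`, which is
harmless because each information quantity involves only one of the two groups.

The channel bounds hold for every code (`cutset_bound`): the letters being i.i.d. and independent of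
the keys, `∑ I(Uᵢ; Xᵢ | Wᵢ) ≤ I(Xⁿ; Bⁿ | K, Wⁿ) ≤ I(Aⁿ; Bⁿ) ≤ ∑ I(Aᵢ; Bᵢ)`, and the same
conditionally on the other user, whose channel input does not depend on the first source given its
own source and the keys.

For the key rates (`key_bound`), with `J` one of `K₁`, `K₂`, `K` and `X = (X₁, X₂)`,
`H(J) ≥ I(J; Xⁿ, Yⁿ | Zⁿ, Wⁿ) = I(J, Bⁿ; Xⁿ, Yⁿ | Zⁿ, Wⁿ) - I(Bⁿ; Xⁿ, Yⁿ | J, Zⁿ, Wⁿ)`. The last term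
is at most `I(Aⁿ; Bⁿ | Zⁿ) + H(Yⁿ | Xⁿ, Wⁿ)`. The other one is at least `∑ I(Uᵢ; Xᵢ, Yᵢ | Wᵢ)` up to
`o(n)`, because `Zⁿ` is nearly independent of `(X, W, Y)ⁿ` and these letters are nearly i.i.d.; this
uses the continuity of entropy (`pmfEntropy_le_add`, `Code.sum_ent_add_le`). Since the slack is a
fixed positive number, one sufficiently good code absorbs the `o(1)` error per letter and the
approximation of a point of the closure by achievable rates.

All entropy inequalities are instances of `ent_submodular`, submodularity on the lattice of
partitions of the sample space, and all Markov chains are expressed by kernels (`HasCond`).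
-/


namespace Coordination

noncomputable section

/-! ### Laws of random variables -/

section Law

variable {Ω α β γ δ : Type*} [Fintype Ω] [Fintype α] [Fintype β] [Fintype γ] [Fintype δ]

lemma nonempty_of_mem_stdSimplex {p : Ω → ℝ} (hp : p ∈ stdSimplex ℝ Ω) :
    Nonempty Ω := by
  by_contra h
  rw [not_nonempty_iff] at h
  have h1 := hp.2
  simp at h1

/-- Change of variables: the expectation of `f (X)` computed from the law of `X`. -/
lemma sum_law_mul (p : Ω → ℝ) (X : Ω → α) (f : α → ℝ) :
    ∑ a, law p X a * f a = ∑ ω, p ω * f (X ω) := by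
  classical
  simp only [law, Finset.sum_mul]
  rw [Finset.sum_comm]
  refine Finset.sum_congr rfl fun ω _ => ?_
  rw [Finset.sum_eq_single (X ω)]
  · simp
  · intro a _ ha
    simp [ha.symm]
  · simp

lemma sum_law (p : Ω → ℝ) (X : Ω → α) : ∑ a, law p X a = ∑ ω, p ω := by
  simpa using sum_law_mul p X fun _ => 1

omit [Fintype α] in
lemma law_nonneg {p : Ω → ℝ} (hp : ∀ ω, 0 ≤ p ω) (X : Ω → α) (a : α) : 0 ≤ law p X a :=
  Finset.sum_nonneg fun ω _ => by split_ifs <;> simp [hp ω]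

lemma law_mem {p : Ω → ℝ} (hp : p ∈ stdSimplex ℝ Ω) (X : Ω → α) : law p X ∈ stdSimplex ℝ α :=
  ⟨law_nonneg hp.1 X, (sum_law p X).trans hp.2⟩

omit [Fintype β] in
lemma law_law (p : Ω → ℝ) (X : Ω → α) (φ : α → β) :
    law (law p X) φ = law p (fun ω => φ (X ω)) := by
  classical
  funext b
  have := sum_law_mul p X fun a => if φ a = b then 1 else 0
  simpa [law] using this

lemma law_id (p : Ω → ℝ) : law p id = p := by
  classical
  funext a
  unfold law
  rw [Finset.sum_eq_single a] <;> simp +contextual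

lemma law_fst (p : α × β → ℝ) (a : α) : law p Prod.fst a = ∑ b, p (a, b) := by
  classical
  unfold law
  rw [Fintype.sum_prod_type, Finset.sum_eq_single a] <;> simp +contextual

lemma law_snd (p : α × β → ℝ) (b : β) : law p Prod.snd b = ∑ a, p (a, b) := by
  classical
  unfold law
  rw [Fintype.sum_prod_type_right, Finset.sum_eq_single b] <;> simp +contextual

omit [Fintype α] in
lemma law_equiv (p : Ω → ℝ) (e : Ω ≃ α) (a : α) : law p e a = p (e.symm a) := by
  classical
  unfold law
  rw [Finset.sum_eq_single (e.symm a)]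
  · simp
  · intro ω _ hω
    rw [if_neg fun h => hω (by rw [← h, e.symm_apply_apply])]
  · simp

lemma law_equiv_fst (p : Ω → ℝ) (e : Ω ≃ α × β) (a : α) :
    law p (fun ω => (e ω).1) a = ∑ b, p (e.symm (a, b)) := by
  rw [← law_law p e Prod.fst, law_fst]
  simp only [law_equiv]

lemma sum_law_pair_left (p : Ω → ℝ) (X : Ω → α) (Y : Ω → β) (b : β) :
    ∑ a, law p (pair X Y) (a, b) = law p Y b := by
  rw [← law_snd, law_law]; rfl

omit [Fintype α] [Fintype β] in
lemma law_le_law_of_factorsThrough {p : Ω → ℝ} (hp : ∀ ω, 0 ≤ p ω) {X : Ω → α} {Y : Ω → β}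
    (h : X.FactorsThrough Y) (ω : Ω) : law p Y (Y ω) ≤ law p X (X ω) := by
  classical
  refine Finset.sum_le_sum fun ω' _ => ?_
  split_ifs with h1 h2 h2
  · exact le_rfl
  · exact absurd (h h1) h2
  · exact hp ω'
  · exact le_rfl

omit [Fintype α] in
lemma le_law {p : Ω → ℝ} (hp : ∀ ω, 0 ≤ p ω) (X : Ω → α) (ω : Ω) : p ω ≤ law p X (X ω) := by
  classical
  unfold law
  refine le_trans (by simp) (Finset.single_le_sum (f := fun ω' => if X ω' = X ω then p ω' else 0)
    (fun i _ => ?_) (Finset.mem_univ ω))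
  split_ifs <;> simp [hp i]

end Law

/-! ### Entropy of random variables -/

section Entropy

variable {Ω α β γ δ : Type*} [Fintype Ω] [Fintype α] [Fintype β] [Fintype γ] [Fintype δ]

/-- The entropy `H(X)`, in bits, of the random variable `X` under `p`. -/
def ent (p : Ω → ℝ) (X : Ω → α) : ℝ := pmfEntropy (law p X)

lemma ent_eq_neg_sum (p : Ω → ℝ) (X : Ω → α) :
    ent p X = -∑ ω, p ω * Real.logb 2 (law p X (X ω)) := by
  rw [ent, pmfEntropy, sum_law_mul]

lemma pmfEntropy_eq_ent_id (p : Ω → ℝ) : pmfEntropy p = ent p id := by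
  rw [ent, law_id]

lemma condEntropy_eq {p : Ω → ℝ} (hp : ∀ ω, 0 ≤ p ω) (X : Ω → α) (Z : Ω → γ) :
    condEntropy p X Z = ent p (pair X Z) - ent p Z := by
  have h := sum_law_mul p (pair X Z) fun a => Real.logb 2 (law p (pair X Z) a / law p Z a.2)
  rw [Fintype.sum_prod_type] at h
  unfold condEntropy
  change -∑ x, ∑ z, law p (pair X Z) (x, z) * _ = _
  refine (congrArg Neg.neg h).trans ?_
  rw [ent_eq_neg_sum, ent_eq_neg_sum, sub_neg_eq_add, neg_add_eq_sub, ← Finset.sum_sub_distrib,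
    ← Finset.sum_neg_distrib]
  refine Finset.sum_congr rfl fun ω _ => ?_
  rcases (hp ω).eq_or_lt with h0 | h0
  · simp [← h0]
  · change -(p ω * Real.logb 2 (_ / law p Z (Z ω))) = _
    rw [Real.logb_div (h0.trans_le (le_law hp (pair X Z) ω)).ne'
      (h0.trans_le (le_law hp Z ω)).ne']
    ring

lemma condMI_eq {p : Ω → ℝ} (hp : ∀ ω, 0 ≤ p ω) (X : Ω → α) (Y : Ω → β) (Z : Ω → γ) :
    condMI p X Y Z = ent p (pair X Z) - ent p Z -
      (ent p (pair X (pair Y Z)) - ent p (pair Y Z)) := by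
  rw [condMI, condEntropy_eq hp, condEntropy_eq hp]; rfl

lemma ent_mono {p : Ω → ℝ} (hp : ∀ ω, 0 ≤ p ω) {X : Ω → α} {Y : Ω → β}
    (h : X.FactorsThrough Y) : ent p X ≤ ent p Y := by
  rw [ent_eq_neg_sum, ent_eq_neg_sum, neg_le_neg_iff]
  refine Finset.sum_le_sum fun ω _ => ?_
  rcases (hp ω).eq_or_lt with h0 | h0
  · simp [← h0]
  · exact mul_le_mul_of_nonneg_left (Real.logb_le_logb_of_le one_lt_two
      (h0.trans_le (le_law hp Y ω)) (law_le_law_of_factorsThrough hp h ω)) h0.le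

/-- Entropy depends only on the partition of the sample space that the variable induces. -/
lemma ent_congr {p : Ω → ℝ} (hp : ∀ ω, 0 ≤ p ω) {X : Ω → α} {Y : Ω → β}
    (h : ∀ ω ω', X ω = X ω' ↔ Y ω = Y ω') : ent p X = ent p Y :=
  le_antisymm (ent_mono hp fun ω ω' => (h ω ω').2) (ent_mono hp fun ω ω' => (h ω ω').1)

/-- Gibbs' inequality, with the reference weight `s` given along the random variable `X`. -/
lemma gibbs {p : Ω → ℝ} (hp : ∀ ω, 0 ≤ p ω) (X : Ω → α) (s : α → ℝ)
    (hs : ∀ a, 0 ≤ s a) (hs1 : ∑ a, s a ≤ ∑ ω, p ω) (hpos : ∀ ω, 0 < p ω → 0 < s (X ω)) :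
    ent p X ≤ -∑ ω, p ω * Real.logb 2 (s (X ω)) := by
  have hl := law_nonneg hp X
  have key : ∀ ω, p ω * Real.logb 2 (s (X ω)) - p ω * Real.logb 2 (law p X (X ω)) ≤
      p ω * ((s (X ω) / law p X (X ω) - 1) / Real.log 2) := by
    intro ω
    rcases (hp ω).eq_or_lt with h0 | h0
    · simp [← h0]
    · have h1 := h0.trans_le (le_law hp X ω)
      have h2 := hpos ω h0
      rw [← mul_sub, ← Real.logb_div h2.ne' h1.ne']
      refine mul_le_mul_of_nonneg_left ?_ h0.le
      exact div_le_div_of_nonneg_right (Real.log_le_sub_one_of_pos (div_pos h2 h1))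
        (Real.log_nonneg one_le_two)
  have hsum := Finset.sum_le_sum fun ω (_ : ω ∈ Finset.univ) => key ω
  rw [Finset.sum_sub_distrib, ← sum_law_mul p X fun a => (s a / law p X a - 1) / Real.log 2] at hsum
  have hle : ∑ a, law p X a * ((s a / law p X a - 1) / Real.log 2) ≤
      ∑ a, (s a - law p X a) / Real.log 2 := by
    refine Finset.sum_le_sum fun a _ => ?_
    rw [← mul_div_assoc]
    refine div_le_div_of_nonneg_right ?_ (Real.log_nonneg one_le_two)
    rcases (hl a).eq_or_lt with h0 | h0
    · simp [← h0, hs a]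
    · rw [mul_sub, mul_div_cancel₀ _ h0.ne', mul_one]
  rw [← Finset.sum_div, Finset.sum_sub_distrib, sum_law] at hle
  have h0 : (∑ a, s a - ∑ ω, p ω) / Real.log 2 ≤ 0 :=
    div_nonpos_of_nonpos_of_nonneg (by linarith) (Real.log_nonneg one_le_two)
  rw [ent_eq_neg_sum]
  linarith

lemma ent_le_logb_card {p : Ω → ℝ} (hp : p ∈ stdSimplex ℝ Ω) (X : Ω → α) :
    ent p X ≤ Real.logb 2 (Fintype.card α) := by
  have hne := nonempty_of_mem_stdSimplex (law_mem hp X)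
  have hc : (0 : ℝ) < Fintype.card α := by exact_mod_cast Fintype.card_pos
  refine (gibbs hp.1 X (fun _ => (Fintype.card α : ℝ)⁻¹) (fun _ => by positivity) ?_
    fun _ _ => by positivity).trans_eq ?_
  · rw [hp.2]; simp
  · rw [← Finset.sum_mul, hp.2]; simp [Real.logb_inv]

/-- Shannon's inequality `I(X; Y | Z) ≥ 0`. -/
lemma ent_pair_submodular {p : Ω → ℝ} (hp : ∀ ω, 0 ≤ p ω) (X : Ω → α) (Y : Ω → β) (Z : Ω → γ) :
    ent p (pair X (pair Y Z)) + ent p Z ≤ ent p (pair X Z) + ent p (pair Y Z) := by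
  have hg := gibbs hp (pair X (pair Y Z))
    (fun a => law p (pair X Z) (a.1, a.2.2) * law p (pair Y Z) a.2 / law p Z a.2.2)
    (fun a => div_nonneg (mul_nonneg (law_nonneg hp _ _) (law_nonneg hp _ _)) (law_nonneg hp _ _))
    ?_ fun ω hω => div_pos (mul_pos (hω.trans_le (le_law hp (pair X Z) ω))
      (hω.trans_le (le_law hp (pair Y Z) ω))) (hω.trans_le (le_law hp Z ω))
  · rw [ent_eq_neg_sum p Z, ent_eq_neg_sum p (pair X Z), ent_eq_neg_sum p (pair Y Z)]
    have : ∑ ω, p ω * Real.logb 2 (law p (pair X Z) (X ω, Z ω) * law p (pair Y Z) (Y ω, Z ω) /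
        law p Z (Z ω)) = ∑ ω, p ω * Real.logb 2 (law p (pair X Z) (pair X Z ω)) +
        ∑ ω, p ω * Real.logb 2 (law p (pair Y Z) (pair Y Z ω)) -
        ∑ ω, p ω * Real.logb 2 (law p Z (Z ω)) := by
      rw [← Finset.sum_add_distrib, ← Finset.sum_sub_distrib]
      refine Finset.sum_congr rfl fun ω _ => ?_
      rcases (hp ω).eq_or_lt with h0 | h0
      · simp [← h0]
      · have h1 := h0.trans_le (le_law hp (pair X Z) ω)
        have h2 := h0.trans_le (le_law hp (pair Y Z) ω)
        have h3 := h0.trans_le (le_law hp Z ω)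
        simp only [pair] at h1 h2 h3 ⊢
        rw [Real.logb_div (mul_pos h1 h2).ne' h3.ne', Real.logb_mul h1.ne' h2.ne']
        ring
    simp only [pair] at hg this ⊢
    linarith
  · rw [← sum_law p Z, Fintype.sum_prod_type_right, Fintype.sum_prod_type_right]
    refine Finset.sum_le_sum fun z _ => ?_
    simp only [← Finset.sum_div, ← Finset.sum_mul]
    rw [sum_law_pair_left, ← Finset.mul_sum, sum_law_pair_left]
    rcases (law_nonneg hp Z z).eq_or_lt with h0 | h0
    · simp [← h0]
    · rw [mul_div_cancel_right₀ _ h0.ne']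

/-- Submodularity of entropy on the lattice of partitions: if `A` and `B` together determine `C`
and each of them determines `D`, then `H(C) + H(D) ≤ H(A) + H(B)`. -/
lemma ent_submodular {p : Ω → ℝ} (hp : ∀ ω, 0 ≤ p ω) {A : Ω → α} {B : Ω → β} {C : Ω → γ} {D : Ω → δ}
    (hC : C.FactorsThrough (pair A B)) (hA : D.FactorsThrough A) (hB : D.FactorsThrough B) :
    ent p C + ent p D ≤ ent p A + ent p B := by
  have h1 : ent p C ≤ ent p (pair A (pair B D)) := ent_mono hp fun ω ω' h => hC (by
    simp only [pair, Prod.mk.injEq] at h ⊢; exact ⟨h.1, h.2.1⟩)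
  have h2 : ent p (pair A D) ≤ ent p A := ent_mono hp fun ω ω' h => by
    simp only [pair, Prod.mk.injEq]; exact ⟨h, hA h⟩
  have h3 : ent p (pair B D) ≤ ent p B := ent_mono hp fun ω ω' h => by
    simp only [pair, Prod.mk.injEq]; exact ⟨h, hB h⟩
  linarith [ent_pair_submodular hp A B D]

lemma ent_const {p : Ω → ℝ} (hp : p ∈ stdSimplex ℝ Ω) (c : α) : ent p (fun _ => c) = 0 := by
  classical
  rw [ent_eq_neg_sum]
  simp [law, hp.2]

lemma ent_pair_le {p : Ω → ℝ} (hp : p ∈ stdSimplex ℝ Ω) (X : Ω → α) (Y : Ω → β) :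
    ent p (pair X Y) ≤ ent p X + ent p Y := by
  have := ent_submodular hp.1 (A := X) (B := Y) (C := pair X Y) (D := fun _ => ())
    (fun _ _ h => h) (fun _ _ _ => rfl) (fun _ _ _ => rfl)
  rwa [ent_const hp, add_zero] at this

/-- Conditional subadditivity `H(X₁, …, Xₙ | Z) ≤ ∑ H(Xᵢ | Z)`. -/
lemma ent_pi_le {ι : Type*} [Fintype ι] [DecidableEq ι] {p : Ω → ℝ} (hp : ∀ ω, 0 ≤ p ω) (X : ι → Ω → α)
    (Z : Ω → γ) :
    ent p (pair (fun ω i => X i ω) Z) - ent p Z ≤ ∑ i, (ent p (pair (X i) Z) - ent p Z) := by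
  have key : ∀ s : Finset ι, ent p (pair (fun ω (i : s) => X i ω) Z) - ent p Z ≤
      ∑ i ∈ s, (ent p (pair (X i) Z) - ent p Z) := by
    intro s
    induction s using Finset.induction_on with
    | empty =>
      rw [Finset.sum_empty, sub_nonpos]
      refine ent_mono hp fun ω ω' h => ?_
      simp only [pair, Prod.mk.injEq]
      exact ⟨funext fun i => absurd i.2 (Finset.notMem_empty _), h⟩
    | insert a s ha ih =>
      rw [Finset.sum_insert ha]
      have := ent_submodular hp (A := pair (X a) Z) (B := pair (fun ω (i : s) => X i ω) Z)
        (C := pair (fun ω (i : (insert a s : Finset ι)) => X i ω) Z) (D := Z) ?_ ?_ ?_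
      · linarith
      · intro ω ω' h
        simp only [pair, Prod.mk.injEq, funext_iff] at h ⊢
        refine ⟨fun i => ?_, h.1.2⟩
        rcases Finset.mem_insert.1 i.2 with h' | h'
        · rw [h']; exact h.1.1
        · exact h.2.1 ⟨i, h'⟩
      · intro ω ω' h
        simp only [pair, Prod.mk.injEq] at h
        exact h.2
      · intro ω ω' h
        simp only [pair, Prod.mk.injEq] at h
        exact h.2
  refine le_trans (le_of_eq ?_) (key Finset.univ)
  rw [sub_left_inj]
  refine ent_congr hp fun ω ω' => ?_
  simp [pair, funext_iff]

end Entropy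

/-! ### Conditional laws given by kernels -/

section Kernel

variable {Ω α β γ δ : Type*} [Fintype Ω] [Fintype α] [Fintype β] [Fintype γ] [Fintype δ]

/-- `κ` is a version of the conditional law of `B` given `V`. Nothing is required of the rows `κ v`
with `P(V = v) = 0`. -/
def HasCond (p : Ω → ℝ) (V : Ω → α) (B : Ω → β) (κ : α → β → ℝ) : Prop :=
  ∀ v b, law p (pair V B) (v, b) = law p V v * κ v b

omit [Fintype γ] in
/-- The Markov property: if the conditional law of `B` given `V` depends on `V` only through
`φ(V)`, it is also the conditional law of `B` given `φ(V)`. -/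
lemma HasCond.map_left {p : Ω → ℝ} {V : Ω → α} {B : Ω → β} {κ : γ → β → ℝ} (φ : α → γ)
    (h : HasCond p V B fun v => κ (φ v)) : HasCond p (fun ω => φ (V ω)) B κ := by
  classical
  intro c b
  have h1 : law p (pair (fun ω => φ (V ω)) B) = law (law p (pair V B)) fun a => (φ a.1, a.2) := by
    rw [law_law]; rfl
  rw [h1, ← law_law p V φ]
  unfold law
  rw [Finset.sum_mul, Fintype.sum_prod_type]
  refine Finset.sum_congr rfl fun v _ => ?_
  rw [Finset.sum_eq_single b]
  · by_cases hv : φ v = c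
    · subst hv
      simpa [law] using h v b
    · simp [hv]
  · intro b' _ hb
    simp [hb]
  · simp

omit [Fintype γ] in
lemma HasCond.map_right {p : Ω → ℝ} {V : Ω → α} {B : Ω → β} {κ : α → β → ℝ} (ψ : β → γ)
    (h : HasCond p V B κ) : HasCond p V (fun ω => ψ (B ω)) fun v => law (κ v) ψ := by
  classical
  intro v c
  have h1 : law p (pair V fun ω => ψ (B ω)) (v, c) =
      ∑ b, if ψ b = c then law p (pair V B) (v, b) else 0 := by
    have h2 : law p (pair V fun ω => ψ (B ω)) = law (law p (pair V B)) fun a => (a.1, ψ a.2) := by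
      rw [law_law]; rfl
    rw [h2]
    generalize law p (pair V B) = r
    unfold law
    rw [Fintype.sum_prod_type, Finset.sum_eq_single v] <;> simp +contextual
  rw [h1]
  simp only [h v]
  generalize law p V v = r
  unfold law
  rw [Finset.mul_sum]
  refine Finset.sum_congr rfl fun b _ => ?_
  split_ifs <;> simp

lemma HasCond.ent_sub {p : Ω → ℝ} (hp : ∀ ω, 0 ≤ p ω) {V : Ω → α} {B : Ω → β} {κ : α → β → ℝ}
    (h : HasCond p V B κ) :
    ent p (pair V B) - ent p V = -∑ ω, p ω * Real.logb 2 (κ (V ω) (B ω)) := by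
  rw [ent_eq_neg_sum, ent_eq_neg_sum, sub_neg_eq_add, neg_add_eq_sub, ← neg_sub,
    ← Finset.sum_sub_distrib]
  congr 1
  refine Finset.sum_congr rfl fun ω _ => ?_
  rcases (hp ω).eq_or_lt with h0 | h0
  · simp [← h0]
  · have h1 := h0.trans_le (le_law hp (pair V B) ω)
    have h2 := h0.trans_le (le_law hp V ω)
    change 0 < law p (pair V B) (V ω, B ω) at h1
    change p ω * Real.logb 2 (law p (pair V B) (V ω, B ω)) - _ = _
    rw [h] at h1 ⊢
    rw [Real.logb_mul h2.ne' (pos_of_mul_pos_right h1 h2.le).ne']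
    ring

/-- `H(B | V) = H(B | φ(V))` when `V - φ(V) - B` is a Markov chain. -/
lemma HasCond.ent_map_left {p : Ω → ℝ} (hp : ∀ ω, 0 ≤ p ω) {V : Ω → α} {B : Ω → β}
    {κ : γ → β → ℝ} (φ : α → γ) (h : HasCond p V B fun v => κ (φ v)) :
    ent p (pair V B) - ent p V = ent p (pair (fun ω => φ (V ω)) B) - ent p fun ω => φ (V ω) := by
  rw [h.ent_sub hp, (h.map_left φ).ent_sub hp]

lemma HasCond.law_eq {p : Ω → ℝ} (hp : p ∈ stdSimplex ℝ Ω) {V : Ω → α} {B : Ω → β} {κ : β → ℝ}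
    (h : HasCond p V B fun _ => κ) : law p B = κ := by
  funext b
  rw [← sum_law_pair_left p V B b, Finset.sum_congr rfl fun v _ => h v b, ← Finset.sum_mul,
    sum_law, hp.2, one_mul]

lemma hasCond_unit {p : Ω → ℝ} (hp : p ∈ stdSimplex ℝ Ω) (B : Ω → β) :
    HasCond p (fun _ => ()) B fun _ => law p B := by
  classical
  intro v b
  have h1 : law p (fun _ => ()) v = 1 := by simp [law, hp.2]
  have h2 := sum_law_pair_left p (fun _ => ()) B b
  rw [Fintype.sum_unique] at h2
  rw [h1, one_mul]
  exact h2

/-! ### Product laws -/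

variable {ι : Type*} [Fintype ι] [DecidableEq ι]

lemma sum_prod_eq_one {k : ι → β → ℝ} (hk : ∀ i, ∑ b, k i b = 1) :
    ∑ b : ι → β, ∏ i, k i (b i) = 1 := by
  classical
  rw [← Fintype.piFinset_univ, ← Finset.prod_univ_sum]
  simp [hk]

lemma prod_mem_stdSimplex {k : ι → β → ℝ} (hk : ∀ i, k i ∈ stdSimplex ℝ β) :
    (fun b : ι → β => ∏ i, k i (b i)) ∈ stdSimplex ℝ (ι → β) :=
  ⟨fun _ => Finset.prod_nonneg fun i _ => (hk i).1 _, sum_prod_eq_one fun i => (hk i).2⟩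

lemma law_prod_eval {k : ι → β → ℝ} (hk : ∀ i, ∑ b, k i b = 1) (i : ι) :
    law (fun b : ι → β => ∏ j, k j (b j)) (fun b => b i) = k i := by
  classical
  funext c
  have h : ∀ b : ι → β, (if b i = c then ∏ j, k j (b j) else 0) =
      ∏ j, if j = i then (if b j = c then k j (b j) else 0) else k j (b j) := by
    intro b
    rw [← Finset.mul_prod_erase _ _ (Finset.mem_univ i),
      ← Finset.mul_prod_erase _ _ (Finset.mem_univ i), if_pos rfl, ite_mul, zero_mul]
    congr 2
    refine Finset.prod_congr rfl fun j hj => ?_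
    rw [if_neg (Finset.ne_of_mem_erase hj)]
  unfold law
  rw [Finset.sum_congr rfl fun b _ => h b, ← Fintype.piFinset_univ,
    ← Finset.prod_univ_sum (f := fun j x => if j = i then (if x = c then k j x else 0) else k j x),
    ← Finset.mul_prod_erase _ _ (Finset.mem_univ i), Finset.prod_eq_one, mul_one]
  · simp
  · intro j hj
    simp [Finset.ne_of_mem_erase hj, hk]

/-- The outputs of a memoryless channel: `H(Bⁿ | V) = ∑ H(Bᵢ | Aᵢ)`, where `Aᵢ = f(V)ᵢ`. -/
lemma HasCond.ent_prod {p : Ω → ℝ} (hp : ∀ ω, 0 ≤ p ω) {V : Ω → α} {B : Ω → ι → β}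
    {k : γ → β → ℝ} (hk : ∀ a, k a ∈ stdSimplex ℝ β) (f : α → ι → γ)
    (h : HasCond p V B fun v b => ∏ i, k (f v i) (b i)) :
    ent p (pair V B) - ent p V =
      ∑ i, (ent p (pair (fun ω => f (V ω) i) fun ω => B ω i) - ent p fun ω => f (V ω) i) := by
  have hi : ∀ i, HasCond p (fun ω => f (V ω) i) (fun ω => B ω i) k := by
    intro i
    refine HasCond.map_left (fun v => f v i) ?_
    have := h.map_right fun b => b i
    simp only [law_prod_eval (fun i => (hk _).2)] at this
    exact this
  rw [h.ent_sub hp, Finset.sum_congr rfl fun i _ => (hi i).ent_sub hp, Finset.sum_neg_distrib,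
    Finset.sum_comm]
  congr 1
  refine Finset.sum_congr rfl fun ω _ => ?_
  rcases (hp ω).eq_or_lt with h0 | h0
  · simp [← h0]
  · have h1 : 0 < law p (pair V B) (V ω, B ω) := h0.trans_le (le_law hp (pair V B) ω)
    rw [h] at h1
    have h2 := pos_of_mul_pos_right h1 (law_nonneg hp V _)
    rw [← Finset.mul_sum, Real.logb_prod _ _ fun i hi => (Finset.prod_ne_zero_iff.1 h2.ne') i hi]

/-! ### Extending a sample space by a kernel -/

/-- The p.m.f. on `Ω × β` with first marginal `p` and conditional law `κ ω` of the second
coordinate. -/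
def ext (p : Ω → ℝ) (κ : Ω → β → ℝ) : Ω × β → ℝ := fun x => p x.1 * κ x.1 x.2

lemma ext_mem {p : Ω → ℝ} (hp : p ∈ stdSimplex ℝ Ω) {κ : Ω → β → ℝ}
    (hκ : ∀ ω, κ ω ∈ stdSimplex ℝ β) : ext p κ ∈ stdSimplex ℝ (Ω × β) := by
  refine ⟨fun x => mul_nonneg (hp.1 _) ((hκ _).1 _), ?_⟩
  rw [Fintype.sum_prod_type]
  simp [ext, ← Finset.mul_sum, (hκ _).2, hp.2]

lemma law_ext_fst (p : Ω → ℝ) {κ : Ω → β → ℝ} (hκ : ∀ ω, κ ω ∈ stdSimplex ℝ β) :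
    law (ext p κ) Prod.fst = p := by
  funext ω
  rw [law_fst]
  simp [ext, ← Finset.mul_sum, (hκ _).2]

omit [Fintype α] in
lemma law_ext (p : Ω → ℝ) {κ : Ω → β → ℝ} (hκ : ∀ ω, κ ω ∈ stdSimplex ℝ β) (V : Ω → α) :
    law (ext p κ) (fun x => V x.1) = law p V := by
  rw [← law_law (ext p κ) Prod.fst V, law_ext_fst p hκ]

lemma hasCond_ext (p : Ω → ℝ) {κ : Ω → β → ℝ} (hκ : ∀ ω, κ ω ∈ stdSimplex ℝ β) :
    HasCond (ext p κ) Prod.fst Prod.snd κ := by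
  intro ω b
  rw [law_ext_fst p hκ]
  exact congrFun (law_id (ext p κ)) (ω, b)

omit [Fintype α] [Fintype β] [Fintype γ] in
/-- Composition of two kernels. -/
lemma HasCond.comp {p : Ω → ℝ} {V : Ω → α} {B : Ω → β} {C : Ω → γ} {κ : α → β → ℝ}
    {κ' : α → β → γ → ℝ} (h : HasCond p V B κ) (h' : HasCond p (pair V B) C fun v => κ' v.1 v.2) :
    HasCond p V (pair B C) fun v => Coordination.ext (κ v) (κ' v) := by
  classical
  rintro v ⟨b, c⟩
  have h1 : law p (pair V (pair B C)) (v, b, c) = law p (pair (pair V B) C) ((v, b), c) := by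
    simp [law, pair, and_assoc]
  rw [h1, h', h, mul_assoc]
  rfl

omit [Fintype α] [Fintype γ] in
lemma HasCond.ext {p : Ω → ℝ} {κ : Ω → β → ℝ} (hκ : ∀ ω, κ ω ∈ stdSimplex ℝ β)
    {V : Ω → α} {C : Ω → γ} {κ' : α → γ → ℝ} (h : HasCond p V C κ') :
    HasCond (Coordination.ext p κ) (fun x => V x.1) (fun x => C x.1) κ' := by
  intro v c
  rw [law_ext p hκ V, ← h v c, ← law_ext p hκ (pair V C)]
  rfl

end Kernel

/-! ### Total variation and continuity of entropy -/

section Continuity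

variable {Ω α β : Type*} [Fintype Ω] [Fintype α] [Fintype β]

lemma tv_law_le (p q : Ω → ℝ) (X : Ω → α) : tv (law p X) (law q X) ≤ tv p q := by
  classical
  unfold tv
  refine mul_le_mul_of_nonneg_left ?_ (by norm_num)
  have h := sum_law_mul (fun ω => |p ω - q ω|) X fun _ => 1
  simp only [mul_one] at h
  rw [← h]
  refine Finset.sum_le_sum fun a _ => ?_
  unfold law
  rw [← Finset.sum_sub_distrib]
  refine (Finset.abs_sum_le_sum_abs _ _).trans (Finset.sum_le_sum fun ω _ => ?_)
  split_ifs <;> simp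

/-- The contribution `-x log x` of a probability `x` to the entropy. -/
def entTerm (x : ℝ) : ℝ := -(x * Real.logb 2 x)

lemma entTerm_add_le {x y : ℝ} (hx : 0 ≤ x) (hy : 0 ≤ y) :
    entTerm (x + y) ≤ entTerm x + entTerm y := by
  unfold entTerm
  rcases hx.eq_or_lt with rfl | hx
  · simp
  rcases hy.eq_or_lt with rfl | hy
  · simp
  have h1 := Real.logb_le_logb_of_le one_lt_two hx (le_add_of_nonneg_right hy.le)
  have h2 := Real.logb_le_logb_of_le one_lt_two hy (le_add_of_nonneg_left hx.le)
  nlinarith [mul_le_mul_of_nonneg_left h1 hx.le, mul_le_mul_of_nonneg_left h2 hy.le]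

lemma le_entTerm_add {x y : ℝ} (hx : 0 ≤ x) (hy : 0 ≤ y) (h : x + y ≤ 1) :
    entTerm x - y / Real.log 2 ≤ entTerm (x + y) := by
  have hl := Real.log_pos one_lt_two
  unfold entTerm
  have h1 : y * Real.logb 2 (x + y) ≤ 0 :=
    mul_nonpos_of_nonneg_of_nonpos hy (Real.logb_nonpos one_lt_two (by linarith) h)
  suffices h2 : x * Real.logb 2 (x + y) - x * Real.logb 2 x ≤ y / Real.log 2 by linarith
  rcases hx.eq_or_lt with rfl | hx
  · simp; positivity
  rw [← mul_sub, ← Real.logb_div (by linarith) hx.ne', Real.logb, ← mul_div_assoc]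
  refine div_le_div_of_nonneg_right ?_ hl.le
  have := Real.log_le_sub_one_of_pos (x := (x + y) / x) (by positivity)
  calc x * Real.log ((x + y) / x) ≤ x * ((x + y) / x - 1) := mul_le_mul_of_nonneg_left this hx.le
    _ = y := by field_simp; ring

lemma entTerm_le {x c : ℝ} (hx : 0 ≤ x) (hc : 0 < c) :
    entTerm x ≤ x * Real.logb 2 c⁻¹ + c / Real.log 2 := by
  have hl := Real.log_pos one_lt_two
  unfold entTerm
  rcases hx.eq_or_lt with rfl | hx
  · simp; positivity
  suffices h2 : x * (Real.logb 2 c - Real.logb 2 x) ≤ c / Real.log 2 by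
    rw [Real.logb_inv]; linarith
  rw [← Real.logb_div hc.ne' hx.ne', Real.logb, ← mul_div_assoc]
  refine div_le_div_of_nonneg_right ?_ hl.le
  have := Real.log_le_sub_one_of_pos (x := c / x) (by positivity)
  calc x * Real.log (c / x) ≤ x * (c / x - 1) := mul_le_mul_of_nonneg_left this hx.le
    _ = c - x := by field_simp
    _ ≤ c := by linarith

/-- A modulus of continuity, in total variation, of the entropy on an alphabet of size `N`. -/
def modulus (N δ : ℝ) : ℝ := δ * Real.logb 2 N + (δ * Real.logb 2 δ⁻¹ + 2 * δ / Real.log 2)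

/-- A Fannes-type inequality. Both p.m.f.s are the sum of their minimum and a remainder of mass
`tv p q`; the entropy of the remainder is at most that of a uniform weight of the same mass. -/
lemma pmfEntropy_le_add {p q : α → ℝ} (hp : p ∈ stdSimplex ℝ α) (hq : q ∈ stdSimplex ℝ α) {δ : ℝ}
    (hδ : 0 < δ) (hδ1 : δ ≤ 1) (h : tv p q ≤ δ) :
    pmfEntropy q ≤ pmfEntropy p + modulus (Fintype.card α) δ := by
  unfold modulus
  have hl := Real.log_pos one_lt_two
  have hne := nonempty_of_mem_stdSimplex hp
  have hN : (1 : ℝ) ≤ Fintype.card α := by exact_mod_cast Fintype.card_pos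
  set N : ℝ := (Fintype.card α : ℝ) with hNdef
  have hmin : ∀ a, 0 ≤ min (p a) (q a) := fun a => le_min (hp.1 a) (hq.1 a)
  have habs : ∀ a, |p a - q a| = (p a - min (p a) (q a)) + (q a - min (p a) (q a)) := by
    intro a
    rcases le_total (p a) (q a) with h' | h'
    · rw [min_eq_left h', abs_of_nonpos (by linarith)]; ring
    · rw [min_eq_right h', abs_of_nonneg (by linarith)]; ring
  have hP : ∑ a, (p a - min (p a) (q a)) ≤ δ := by
    unfold tv at h
    simp only [habs, Finset.sum_add_distrib, Finset.sum_sub_distrib, hp.2, hq.2] at h ⊢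
    linarith
  have hQ : ∑ a, (q a - min (p a) (q a)) ≤ δ := by
    unfold tv at h
    simp only [habs, Finset.sum_add_distrib, Finset.sum_sub_distrib, hp.2, hq.2] at h ⊢
    linarith
  have hp1 : ∀ a, p a ≤ 1 := fun a => hp.2 ▸ Finset.single_le_sum (fun i _ => hp.1 i)
    (Finset.mem_univ a)
  have key : ∀ a, entTerm (q a) - entTerm (p a) ≤
      ((q a - min (p a) (q a)) * Real.logb 2 (δ / N)⁻¹ + δ / N / Real.log 2) +
        (p a - min (p a) (q a)) / Real.log 2 := by
    intro a
    have h1 := entTerm_add_le (hmin a) (sub_nonneg.2 (min_le_right (p a) (q a)))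
    have h2 := le_entTerm_add (hmin a) (sub_nonneg.2 (min_le_left (p a) (q a)))
      (by linarith [hp1 a])
    have h3 := entTerm_le (sub_nonneg.2 (min_le_right (p a) (q a))) (c := δ / N) (by positivity)
    rw [add_sub_cancel] at h1 h2
    linarith
  have hsum := Finset.sum_le_sum fun a (_ : a ∈ Finset.univ) => key a
  simp only [Finset.sum_sub_distrib (f := fun a => entTerm (q a)), Finset.sum_add_distrib,
    ← Finset.sum_mul, ← Finset.sum_div (f := fun a => p a - min (p a) (q a))] at hsum
  have hpe : pmfEntropy p = ∑ a, entTerm (p a) := by simp [pmfEntropy, entTerm]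
  have hqe : pmfEntropy q = ∑ a, entTerm (q a) := by simp [pmfEntropy, entTerm]
  have hlog : Real.logb 2 (δ / N)⁻¹ = Real.logb 2 N + Real.logb 2 δ⁻¹ := by
    rw [inv_div, div_eq_mul_inv, Real.logb_mul (by positivity) (by positivity)]
  have hlog0 : 0 ≤ Real.logb 2 (δ / N)⁻¹ :=
    Real.logb_nonneg one_lt_two (one_le_inv₀ (by positivity) |>.2 (by
      rw [div_le_one (by positivity)]; linarith))
  have hc : ∑ _a : α, δ / N / Real.log 2 = δ / Real.log 2 := by
    rw [Finset.sum_const, Finset.card_univ, nsmul_eq_mul]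
    rw [← hNdef]
    field_simp
  have h4 := mul_le_mul_of_nonneg_right hQ hlog0
  have h5 := div_le_div_of_nonneg_right hP hl.le
  rw [hc] at hsum
  rw [hpe, hqe]
  have h6 : δ * Real.logb 2 (δ / N)⁻¹ = δ * Real.logb 2 N + δ * Real.logb 2 δ⁻¹ := by
    rw [hlog]; ring
  have h7 : 2 * δ / Real.log 2 = δ / Real.log 2 + δ / Real.log 2 := by ring
  linarith

end Continuity

/-! ### Single-letterization of the entropy inequalities -/

section SingleLetter

variable {Ω : Type*} [Fintype Ω] {n : ℕ}

lemma ent_pi_le_sum {α : Type*} [Fintype α] {p : Ω → ℝ} (hp : p ∈ stdSimplex ℝ Ω)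
    (X : Ω → Fin n → α) : ent p X ≤ ∑ i, ent p fun ω => X ω i := by
  have h := ent_pi_le hp.1 (fun i ω => X ω i) fun _ => ()
  rw [ent_const hp] at h
  simp only [sub_zero] at h
  have h1 : ent p (pair (fun ω i => X ω i) fun _ => ()) = ent p X :=
    ent_congr hp.1 fun ω ω' => by simp [pair, funext_iff]
  have h2 : ∀ i, ent p (pair (fun ω => X ω i) fun _ => ()) = ent p fun ω => X ω i :=
    fun i => ent_congr hp.1 fun ω ω' => by simp [pair]
  rw [h1] at h
  simpa only [h2] using h

/-- `H(Yⁿ | Zⁿ) ≤ ∑ H(Yᵢ | Zᵢ)`. -/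
lemma condEnt_pi_le_sum {α β : Type*} [Fintype α] [Fintype β] {p : Ω → ℝ} (hp : ∀ ω, 0 ≤ p ω)
    (Y : Ω → Fin n → α) (Z : Ω → Fin n → β) :
    ent p (pair Y Z) - ent p Z ≤
      ∑ i, (ent p (pair (fun ω => Y ω i) fun ω => Z ω i) - ent p fun ω => Z ω i) := by
  refine (ent_pi_le hp (fun i ω => Y ω i) Z).trans (Finset.sum_le_sum fun i _ => ?_)
  have := ent_submodular hp (A := Z) (B := pair (fun ω => Y ω i) fun ω => Z ω i)
    (C := pair (fun ω => Y ω i) Z) (D := fun ω => Z ω i)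
    (fun ω ω' h => by simp_all [pair]) (fun ω ω' h => by simp_all) (fun ω ω' h => by simp_all [pair])
  linarith

variable {σ φ γ κ 𝓐 𝓛 𝓑 𝓩 : Type*} [Fintype σ] [Fintype φ] [Fintype γ] [Fintype κ] [Fintype 𝓐]
  [Fintype 𝓛] [Fintype 𝓑] [Fintype 𝓩]

/-- The cut-set bound. The source letters `S` split into a part `f(S)` and a part `g(S)`, and `l` is
the part of the channel inputs that, given `g(S)ⁿ` and the keys `K`, does not depend on `f(S)ⁿ`. The
information on `f(S)ⁿ` in the channel output is at most `I(Aⁿ; Bⁿ | l(A)ⁿ)`. -/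
lemma cutset_bound {p : Ω → ℝ} (hp : p ∈ stdSimplex ℝ Ω) (S : Ω → Fin n → σ) (K : Ω → κ)
    (A : Ω → Fin n → 𝓐) (B : Ω → Fin n → 𝓑) (Z : Ω → Fin n → 𝓩) (f : σ → φ) (g : σ → γ) (l : 𝓐 → 𝓛)
    (hfg : ∀ s s', f s = f s' → g s = g s' → s = s')
    (hS : ent p S = ∑ i, ent p fun ω => S ω i)
    (hK : ent p (pair S K) = ent p S + ent p K)
    (hL : ent p (pair (fun ω i => l (A ω i)) (pair (fun ω i => g (S ω i)) K)) -
        ent p (pair (fun ω i => g (S ω i)) K) ≤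
      ent p (pair (fun ω i => l (A ω i)) (pair S K)) - ent p (pair S K))
    (hO : ent p (pair (pair (pair S K) A) (pair B Z)) - ent p (pair (pair S K) A) =
      ∑ i, (ent p (pair (fun ω => A ω i) (pair (fun ω => B ω i) fun ω => Z ω i)) -
        ent p fun ω => A ω i)) :
    ∑ i, (ent p (fun ω => S ω i) - ent p (fun ω => g (S ω i)) -
      (ent p (pair (fun ω => f (S ω i)) (pair (pair K B) fun ω i => g (S ω i))) -
        ent p (pair (pair K B) fun ω i => g (S ω i)))) ≤
    ∑ i, (ent p (pair (fun ω => B ω i) fun ω => l (A ω i)) - ent p (fun ω => l (A ω i)) -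
      (ent p (pair (fun ω => A ω i) fun ω => B ω i) - ent p fun ω => A ω i)) := by
  have h0 := hp.1
  set G : Ω → Fin n → γ := fun ω i => g (S ω i) with hG
  set F : Ω → Fin n → φ := fun ω i => f (S ω i) with hF
  set L : Ω → Fin n → 𝓛 := fun ω i => l (A ω i) with hL_def
  have e1 : ent p G ≤ ∑ i, ent p fun ω => G ω i := ent_pi_le_sum hp G
  have e2 := ent_pi_le h0 (fun i ω => F ω i) (pair (pair K B) G)
  have e3 : ent p (pair (fun ω i => F ω i) (pair (pair K B) G)) = ent p (pair (pair S K) B) := by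
    refine ent_congr h0 fun ω ω' => ?_
    simp only [pair, hF, hG, Prod.mk.injEq, funext_iff]
    constructor
    · rintro ⟨h1, ⟨h2, h3⟩, h4⟩
      exact ⟨⟨fun i => hfg _ _ (h1 i) (h4 i), h2⟩, h3⟩
    · rintro ⟨⟨h1, h2⟩, h3⟩
      simp_all
  have e4 := ent_pair_le hp G K
  -- giving `L` to the receiver: `I(F; B | G, K) ≤ I(F; B, L | G, K)`
  have e5 := ent_submodular h0 (A := pair (pair S K) B) (B := pair L (pair (pair K B) G))
    (C := pair (pair L (pair S K)) B) (D := pair (pair K B) G)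
    (fun ω ω' h => by simp_all [pair]) (fun ω ω' h => by simp_all [pair])
    (fun ω ω' h => by simp_all [pair])
  have e6 := ent_submodular h0 (A := pair B L) (B := pair L (pair G K))
    (C := pair L (pair (pair K B) G)) (D := L)
    (fun ω ω' h => by simp_all [pair]) (fun ω ω' h => by simp_all [pair])
    (fun ω ω' h => by simp_all [pair])
  have e7 := ent_submodular h0 (A := pair (pair L (pair S K)) B) (B := pair (pair S K) A)
    (C := pair (pair (pair S K) A) B) (D := pair L (pair S K))
    (fun ω ω' h => by simp_all [pair]) (fun ω ω' h => by simp_all [pair])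
    (fun ω ω' h => by simp_all [pair, L])
  have e8 := condEnt_pi_le_sum h0 B L
  -- `H(Bⁿ | Aⁿ)` is bounded below by `H(Bⁿ, Zⁿ | Aⁿ) - ∑ H(Zᵢ | Aᵢ, Bᵢ)`
  have e9 := condEnt_pi_le_sum h0 Z (fun ω i => (A ω i, B ω i))
  have e10 := ent_submodular h0 (A := pair (pair (pair S K) A) B)
    (B := pair Z (fun ω i => (A ω i, B ω i)))
    (C := pair (pair (pair S K) A) (pair B Z)) (D := fun ω i => (A ω i, B ω i))
    (fun ω ω' h => by simp_all [pair]) (fun ω ω' h => by simp_all [pair])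
    (fun ω ω' h => by simp_all [pair])
  have e11 : ∀ i, ent p (pair (fun ω => Z ω i) fun ω => (A ω i, B ω i)) =
      ent p (pair (fun ω => A ω i) (pair (fun ω => B ω i) fun ω => Z ω i)) := fun i =>
    ent_congr h0 fun ω ω' => by simp only [pair, Prod.mk.injEq]; tauto
  have e12 : ∀ i, ent p (fun ω => (A ω i, B ω i)) = ent p (pair (fun ω => A ω i) fun ω => B ω i) :=
    fun i => rfl
  simp only [e11, e12] at e9
  simp only [Finset.sum_sub_distrib] at *
  linarith

variable {ξ ψ η : Type*} [Fintype ξ] [Fintype ψ] [Fintype η]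

/-- The key rate bound. It combines `H(J) ≥ I(J; Xⁿ, Yⁿ | Zⁿ, Wⁿ)` with
`I(Bⁿ; Xⁿ, Yⁿ | J, Zⁿ, Wⁿ) ≤ I(Aⁿ; Bⁿ | Zⁿ) + H(Yⁿ | Xⁿ, Wⁿ)`. -/
lemma key_bound {p : Ω → ℝ} (hp : p ∈ stdSimplex ℝ Ω) (X : Ω → Fin n → ξ) (W : Ω → Fin n → ψ)
    (J : Ω → κ) (A : Ω → Fin n → 𝓐) (B : Ω → Fin n → 𝓑) (Z : Ω → Fin n → 𝓩) (Y : Ω → Fin n → η)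
    (hO : ∑ i, (ent p (pair (fun ω => A ω i) (pair (fun ω => B ω i) fun ω => Z ω i)) -
        ent p fun ω => A ω i) ≤
      ent p (pair (pair (pair (pair X W) J) A) (pair B Z)) - ent p (pair (pair (pair X W) J) A)) :
    ent p (pair (pair X W) (pair Y Z)) - ent p Z - ent p W -
      ∑ i, (ent p (pair (pair (fun ω => X ω i) fun ω => Y ω i) (pair (pair J B) W)) -
        ent p (pair (pair J B) W)) -
      ∑ i, (ent p (pair (fun ω => B ω i) fun ω => Z ω i) - ent p (fun ω => Z ω i) -
        (ent p (pair (fun ω => A ω i) (pair (fun ω => B ω i) fun ω => Z ω i)) -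
          ent p (pair (fun ω => A ω i) fun ω => Z ω i))) -
      ∑ i, (ent p (pair (fun ω => Y ω i) (pair (fun ω => X ω i) fun ω => W ω i)) -
        ent p (pair (fun ω => X ω i) fun ω => W ω i)) ≤ ent p J := by
  have h0 := hp.1
  have e1 := ent_pair_le hp Z W
  -- `I(J; X, Y | Z, W) ≤ H(J)`
  have e2 := ent_pair_le hp J (pair Z W)
  have e2a : ent p (pair (pair X W) (pair Y Z)) ≤ ent p (pair J (pair (pair X W) (pair Y Z))) :=
    ent_mono h0 fun ω ω' h => by simp_all [pair]
  -- `H(B | J, Z, W) ≤ H(B | Z)`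
  have e3 := ent_submodular h0 (A := pair J (pair Z W)) (B := pair B Z)
    (C := pair (pair J B) (pair Z W)) (D := Z)
    (fun ω ω' h => by simp_all [pair]) (fun ω ω' h => by simp_all [pair])
    (fun ω ω' h => by simp_all [pair])
  have e4 := condEnt_pi_le_sum h0 B Z
  -- `H(X, Y | J, B, Z, W) ≤ ∑ H(Xᵢ, Yᵢ | J, B, W)`
  have e5 := ent_submodular h0 (A := pair (pair J B) (pair Z W))
    (B := pair (fun ω i => (X ω i, Y ω i)) (pair (pair J B) W))
    (C := pair (pair (pair X W) (pair Y Z)) (pair J B)) (D := pair (pair J B) W)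
    (fun ω ω' h => by simp_all [pair, funext_iff]) (fun ω ω' h => by simp_all [pair])
    (fun ω ω' h => by simp_all [pair])
  have e6 := ent_pi_le h0 (fun i ω => (X ω i, Y ω i)) (pair (pair J B) W)
  -- `H(B | X, Y, J, Z, W) ≥ H(B | X, Y, J, Z, W, A)`
  have e7 := ent_submodular h0 (A := pair (pair (pair X W) (pair Y Z)) (pair J B))
    (B := pair (pair J (pair (pair X W) (pair Y Z))) A)
    (C := pair (pair (pair (pair X W) (pair Y Z)) (pair J B)) A)
    (D := pair J (pair (pair X W) (pair Y Z)))
    (fun ω ω' h => by simp_all [pair]) (fun ω ω' h => by simp_all [pair])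
    (fun ω ω' h => by simp_all [pair])
  -- `H(Y | X, J, Z, W, A) ≤ H(Y | X, W)`
  have e8 := ent_submodular h0 (A := pair Y fun ω i => (X ω i, W ω i))
    (B := pair (pair (pair (pair X W) J) A) Z)
    (C := pair (pair J (pair (pair X W) (pair Y Z))) A)
    (D := fun ω i => (X ω i, W ω i))
    (fun ω ω' h => by simp_all [pair, funext_iff]) (fun ω ω' h => by simp_all [pair])
    (fun ω ω' h => by simp_all [pair])
  have e9 := condEnt_pi_le_sum h0 Y fun ω i => (X ω i, W ω i)
  -- `H(Z | X, J, W, A) ≤ ∑ H(Zᵢ | Aᵢ)`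
  have e10 := ent_submodular h0 (A := pair Z A) (B := pair (pair (pair X W) J) A)
    (C := pair (pair (pair (pair X W) J) A) Z) (D := A)
    (fun ω ω' h => by simp_all [pair]) (fun ω ω' h => by simp_all [pair])
    (fun ω ω' h => by simp_all [pair])
  have e11 := condEnt_pi_le_sum h0 Z A
  have e12 : ent p (pair (pair (pair (pair X W) J) A) (pair B Z)) ≤
      ent p (pair (pair (pair (pair X W) (pair Y Z)) (pair J B)) A) :=
    ent_mono h0 fun ω ω' h => by simp_all [pair]
  have e13 : ∀ i, ent p (pair (fun ω => Z ω i) fun ω => A ω i) =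
      ent p (pair (fun ω => A ω i) fun ω => Z ω i) := fun i =>
    ent_congr h0 fun ω ω' => by simp only [pair, Prod.mk.injEq]; tauto
  simp only [e13] at e11
  unfold pair at *
  simp only [Finset.sum_sub_distrib] at *
  linarith

end SingleLetter

/-! ### The sample space of a code -/

section Code

variable {𝓧₁ 𝓧₂ 𝓦 𝓨 𝓐₁ 𝓐₂ 𝓑 𝓩 : Type*} [Fintype 𝓧₁] [Fintype 𝓧₂] [Fintype 𝓦] [Fintype 𝓨]
  [Fintype 𝓐₁] [Fintype 𝓐₂] [Fintype 𝓑] [Fintype 𝓩] {M₁ M₂ n : ℕ}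

/-- The values of all random variables of a code, in the order in which they are generated:
source letters, keys, channel inputs, channel outputs, simulated outputs. -/
abbrev Space (𝓧₁ 𝓧₂ 𝓦 𝓨 𝓐₁ 𝓐₂ 𝓑 𝓩 : Type*) (M₁ M₂ n : ℕ) : Type _ :=
  ((((Fin n → 𝓧₁ × 𝓧₂ × 𝓦) × (Fin M₁ × Fin M₂)) × (Fin n → 𝓐₁ × 𝓐₂)) × (Fin n → 𝓑 × 𝓩)) ×
    (Fin n → 𝓨)

section Variables

/-- The source letters `(X₁, X₂, W)ⁿ`. -/
def spS (ω : Space 𝓧₁ 𝓧₂ 𝓦 𝓨 𝓐₁ 𝓐₂ 𝓑 𝓩 M₁ M₂ n) : Fin n → 𝓧₁ × 𝓧₂ × 𝓦 := ω.1.1.1.1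

/-- The keys `(K₁, K₂)`. -/
def spK (ω : Space 𝓧₁ 𝓧₂ 𝓦 𝓨 𝓐₁ 𝓐₂ 𝓑 𝓩 M₁ M₂ n) : Fin M₁ × Fin M₂ := ω.1.1.1.2

/-- The channel inputs `(A₁, A₂)ⁿ`. -/
def spA (ω : Space 𝓧₁ 𝓧₂ 𝓦 𝓨 𝓐₁ 𝓐₂ 𝓑 𝓩 M₁ M₂ n) : Fin n → 𝓐₁ × 𝓐₂ := ω.1.1.2

/-- The channel outputs `(B, Z)ⁿ`. -/
def spO (ω : Space 𝓧₁ 𝓧₂ 𝓦 𝓨 𝓐₁ 𝓐₂ 𝓑 𝓩 M₁ M₂ n) : Fin n → 𝓑 × 𝓩 := ω.1.2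

/-- The simulated outputs `Yⁿ`. -/
def spY (ω : Space 𝓧₁ 𝓧₂ 𝓦 𝓨 𝓐₁ 𝓐₂ 𝓑 𝓩 M₁ M₂ n) : Fin n → 𝓨 := ω.2

/-- The outputs `Bⁿ` of the legitimate receiver. -/
def spB (ω : Space 𝓧₁ 𝓧₂ 𝓦 𝓨 𝓐₁ 𝓐₂ 𝓑 𝓩 M₁ M₂ n) : Fin n → 𝓑 := fun i => (spO ω i).1

/-- The outputs `Zⁿ` of the eavesdropper. -/
def spZ (ω : Space 𝓧₁ 𝓧₂ 𝓦 𝓨 𝓐₁ 𝓐₂ 𝓑 𝓩 M₁ M₂ n) : Fin n → 𝓩 := fun i => (spO ω i).2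

/-- The coordinated letters `(X₁, X₂, W, Y)ⁿ`. -/
def spQ (ω : Space 𝓧₁ 𝓧₂ 𝓦 𝓨 𝓐₁ 𝓐₂ 𝓑 𝓩 M₁ M₂ n) : Fin n → 𝓧₁ × 𝓧₂ × 𝓦 × 𝓨 :=
  fun i => ((spS ω i).1, (spS ω i).2.1, (spS ω i).2.2, spY ω i)

end Variables

/-- The law of one source letter. -/
def srcLaw (q : 𝓧₁ × 𝓧₂ × 𝓦 × 𝓨 → ℝ) : 𝓧₁ × 𝓧₂ × 𝓦 → ℝ := fun s => source q s.1 s.2.1 s.2.2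

/-- The conditional law of the channel inputs given source letters and keys. -/
def Code.encKernel (c : Code 𝓧₁ 𝓧₂ 𝓦 𝓨 𝓐₁ 𝓐₂ 𝓑 M₁ M₂ n)
    (v : (Fin n → 𝓧₁ × 𝓧₂ × 𝓦) × (Fin M₁ × Fin M₂)) (a : Fin n → 𝓐₁ × 𝓐₂) : ℝ :=
  c.enc₁ (fun i => (v.1 i).1) v.2.1 (fun i => (a i).1) *
    c.enc₂ (fun i => (v.1 i).2.1) v.2.2 (fun i => (a i).2)

/-- The joint p.m.f. of the code on `Space`, as a succession of kernels. -/
def Code.pmf (c : Code 𝓧₁ 𝓧₂ 𝓦 𝓨 𝓐₁ 𝓐₂ 𝓑 M₁ M₂ n) (q : 𝓧₁ × 𝓧₂ × 𝓦 × 𝓨 → ℝ)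
    (ch : 𝓐₁ × 𝓐₂ → 𝓑 × 𝓩 → ℝ) : Space 𝓧₁ 𝓧₂ 𝓦 𝓨 𝓐₁ 𝓐₂ 𝓑 𝓩 M₁ M₂ n → ℝ :=
  ext (ext (ext (ext (fun s => ∏ i, srcLaw q (s i)) fun _ _ => 1 / ((M₁ : ℝ) * (M₂ : ℝ)))
    c.encKernel) fun v o => ∏ i, ch (v.2 i) (o i))
    fun v => c.dec v.1.1.2.1 v.1.1.2.2 (fun i => (v.1.1.1 i).2.2) fun i => (v.2 i).1

lemma srcLaw_mem {q : 𝓧₁ × 𝓧₂ × 𝓦 × 𝓨 → ℝ} (hq : q ∈ stdSimplex ℝ (𝓧₁ × 𝓧₂ × 𝓦 × 𝓨)) :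
    srcLaw q ∈ stdSimplex ℝ (𝓧₁ × 𝓧₂ × 𝓦) := by
  refine ⟨fun s => Finset.sum_nonneg fun y _ => hq.1 _, ?_⟩
  rw [← hq.2]
  simp [Fintype.sum_prod_type, srcLaw, source]

lemma unif_mem (hM₁ : 0 < M₁) (hM₂ : 0 < M₂) :
    (fun _ => 1 / ((M₁ : ℝ) * (M₂ : ℝ))) ∈ stdSimplex ℝ (Fin M₁ × Fin M₂) := by
  have h1 : (M₁ : ℝ) ≠ 0 := by exact_mod_cast hM₁.ne'
  have h2 : (M₂ : ℝ) ≠ 0 := by exact_mod_cast hM₂.ne'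
  refine ⟨fun _ => by positivity, ?_⟩
  simp
  field_simp

/-- Reading a sequence of pairs as a pair of sequences. -/
lemma sum_unzip {n : ℕ} {α β : Type*} [Fintype α] [Fintype β] (f : (Fin n → α × β) → ℝ) :
    ∑ a, f a = ∑ a₁ : Fin n → α, ∑ a₂ : Fin n → β, f fun i => (a₁ i, a₂ i) := by
  rw [← Fintype.sum_prod_type',
    ← Equiv.sum_comp (Equiv.arrowProdEquivProdArrow (Fin n) (fun _ => α) fun _ => β).symm]
  rfl

omit [Fintype 𝓧₁] [Fintype 𝓧₂] [Fintype 𝓦] [Fintype 𝓑] in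
lemma Code.encKernel_mem (c : Code 𝓧₁ 𝓧₂ 𝓦 𝓨 𝓐₁ 𝓐₂ 𝓑 M₁ M₂ n)
    (v : (Fin n → 𝓧₁ × 𝓧₂ × 𝓦) × (Fin M₁ × Fin M₂)) :
    c.encKernel v ∈ stdSimplex ℝ (Fin n → 𝓐₁ × 𝓐₂) := by
  refine ⟨fun a => mul_nonneg ((c.enc₁_mem _ _).1 _) ((c.enc₂_mem _ _).1 _), ?_⟩
  rw [sum_unzip]
  simp only [Code.encKernel, ← Finset.mul_sum, (c.enc₂_mem _ _).2, mul_one, (c.enc₁_mem _ _).2]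

section Facts

variable (c : Code 𝓧₁ 𝓧₂ 𝓦 𝓨 𝓐₁ 𝓐₂ 𝓑 M₁ M₂ n) {q : 𝓧₁ × 𝓧₂ × 𝓦 × 𝓨 → ℝ}
  (hq : q ∈ stdSimplex ℝ (𝓧₁ × 𝓧₂ × 𝓦 × 𝓨)) {ch : 𝓐₁ × 𝓐₂ → 𝓑 × 𝓩 → ℝ}
  (hch : ∀ a, ch a ∈ stdSimplex ℝ (𝓑 × 𝓩)) (hM₁ : 0 < M₁) (hM₂ : 0 < M₂)

include hq hch hM₁ hM₂ in
lemma Code.pmf_mem : c.pmf q ch ∈ stdSimplex ℝ (Space 𝓧₁ 𝓧₂ 𝓦 𝓨 𝓐₁ 𝓐₂ 𝓑 𝓩 M₁ M₂ n) :=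
  ext_mem (ext_mem (ext_mem (ext_mem (prod_mem_stdSimplex fun _ => srcLaw_mem hq)
    fun _ => unif_mem hM₁ hM₂) c.encKernel_mem) fun _ => prod_mem_stdSimplex fun _ => hch _)
    fun _ => c.dec_mem _ _ _ _

include hch hM₁ hM₂ in
lemma Code.law_spS : law (c.pmf q ch) spS = fun s => ∏ i, srcLaw q (s i) := by
  refine (law_ext _ (fun _ => c.dec_mem _ _ _ _)
    fun v : (((Fin n → 𝓧₁ × 𝓧₂ × 𝓦) × (Fin M₁ × Fin M₂)) × (Fin n → 𝓐₁ × 𝓐₂)) × (Fin n → 𝓑 × 𝓩) =>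
      v.1.1.1).trans ?_
  refine (law_ext _ (fun _ => prod_mem_stdSimplex fun _ => hch _)
    fun v : ((Fin n → 𝓧₁ × 𝓧₂ × 𝓦) × (Fin M₁ × Fin M₂)) × (Fin n → 𝓐₁ × 𝓐₂) => v.1.1).trans ?_
  refine (law_ext _ c.encKernel_mem fun v => v.1).trans ?_
  exact law_ext_fst _ fun _ => unif_mem hM₁ hM₂

include hch hM₁ hM₂ in
lemma Code.hasCond_spK :
    HasCond (c.pmf q ch) spS spK fun _ _ => 1 / ((M₁ : ℝ) * (M₂ : ℝ)) :=
  (((hasCond_ext _ fun _ => unif_mem hM₁ hM₂).ext c.encKernel_mem).ext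
    fun _ => prod_mem_stdSimplex fun _ => hch _).ext fun _ => c.dec_mem _ _ _ _

include hch in
lemma Code.hasCond_spA : HasCond (c.pmf q ch) (pair spS spK) spA c.encKernel :=
  ((hasCond_ext _ c.encKernel_mem).ext
    fun _ => prod_mem_stdSimplex fun _ => hch _).ext fun _ => c.dec_mem _ _ _ _

include hch in
lemma Code.hasCond_spO : HasCond (c.pmf q ch) (pair (pair spS spK) spA) spO
    fun v o => ∏ i, ch (v.2 i) (o i) :=
  (hasCond_ext _ fun _ => prod_mem_stdSimplex fun _ => hch _).ext fun _ => c.dec_mem _ _ _ _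

lemma Code.hasCond_spY : HasCond (c.pmf q ch) (pair (pair (pair spS spK) spA) spO) spY
    fun v => c.dec v.1.1.2.1 v.1.1.2.2 (fun i => (v.1.1.1 i).2.2) fun i => (v.2 i).1 :=
  hasCond_ext _ fun _ => c.dec_mem _ _ _ _

/-! ### The induced and the ideal p.m.f. -/

/-- `Space` as the product of the alphabets of `(X₁ⁿ, X₂ⁿ, Wⁿ, Yⁿ, Zⁿ)` and of the remaining
variables. -/
def spaceEquiv : Space 𝓧₁ 𝓧₂ 𝓦 𝓨 𝓐₁ 𝓐₂ 𝓑 𝓩 M₁ M₂ n ≃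
    ((Fin n → 𝓧₁) × (Fin n → 𝓧₂) × (Fin n → 𝓦) × (Fin n → 𝓨) × (Fin n → 𝓩)) ×
      (Fin M₁ × Fin M₂ × (Fin n → 𝓐₁) × (Fin n → 𝓐₂) × (Fin n → 𝓑)) where
  toFun ω := ((fun i => (spS ω i).1, fun i => (spS ω i).2.1, fun i => (spS ω i).2.2, spY ω, spZ ω),
    ((spK ω).1, (spK ω).2, fun i => (spA ω i).1, fun i => (spA ω i).2, spB ω))
  invFun v := ((((fun i => (v.1.1 i, v.1.2.1 i, v.1.2.2.1 i), (v.2.1, v.2.2.1)),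
    fun i => (v.2.2.2.1 i, v.2.2.2.2.1 i)), fun i => (v.2.2.2.2.2 i, v.1.2.2.2.2 i)), v.1.2.2.2.1)
  left_inv _ := rfl
  right_inv _ := rfl

/-- The coordinated letters, grouped by position, next to the observations of the eavesdropper. -/
def zipEquiv : ((Fin n → 𝓧₁) × (Fin n → 𝓧₂) × (Fin n → 𝓦) × (Fin n → 𝓨) × (Fin n → 𝓩)) ≃
    (Fin n → 𝓩) × (Fin n → 𝓧₁ × 𝓧₂ × 𝓦 × 𝓨) where
  toFun v := (v.2.2.2.2, fun i => (v.1 i, v.2.1 i, v.2.2.1 i, v.2.2.2.1 i))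
  invFun u := (fun i => (u.2 i).1, fun i => (u.2 i).2.1, fun i => (u.2 i).2.2.1,
    fun i => (u.2 i).2.2.2, u.1)
  left_inv _ := rfl
  right_inv _ := rfl

/-- The observations of the eavesdropper, next to the coordinated sequences. -/
def obsEquiv : ((Fin n → 𝓧₁) × (Fin n → 𝓧₂) × (Fin n → 𝓦) × (Fin n → 𝓨) × (Fin n → 𝓩)) ≃
    (Fin n → 𝓩) × ((Fin n → 𝓧₁) × (Fin n → 𝓧₂) × (Fin n → 𝓦) × (Fin n → 𝓨)) where
  toFun v := (v.2.2.2.2, v.1, v.2.1, v.2.2.1, v.2.2.2.1)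
  invFun u := (u.2.1, u.2.2.1, u.2.2.2.1, u.2.2.2.2, u.1)
  left_inv _ := rfl
  right_inv _ := rfl

lemma Code.induced_eq : c.induced q ch = law (c.pmf q ch) fun ω => (spaceEquiv ω).1 := by
  funext ⟨x₁, x₂, w, y, z⟩
  rw [law_equiv_fst]
  simp only [Fintype.sum_prod_type, Code.induced]
  refine Finset.sum_congr rfl fun k₁ _ => Finset.sum_congr rfl fun k₂ _ =>
    Finset.sum_congr rfl fun a₁ _ => Finset.sum_congr rfl fun a₂ _ =>
    Finset.sum_congr rfl fun b _ => ?_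
  change c.joint q ch x₁ x₂ w k₁ k₂ a₁ a₂ b z y = c.pmf q ch ((((fun i => (x₁ i, x₂ i, w i),
    (k₁, k₂)), fun i => (a₁ i, a₂ i)), fun i => (b i, z i)), y)
  simp only [Code.joint, Code.pmf, ext, Code.encKernel, srcLaw]
  ring

lemma Code.inducedZ_eq : c.inducedZ q ch = law (c.pmf q ch) spZ := by
  funext z
  have h := law_equiv_fst (c.induced q ch) obsEquiv z
  simp only [Fintype.sum_prod_type] at h
  refine Eq.trans ?_ (h.symm.trans ?_)
  · rfl
  · rw [Code.induced_eq, law_law]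
    rfl

lemma Code.law_spZ_spQ : law (c.pmf q ch) (pair spZ spQ) = law (c.induced q ch) zipEquiv := by
  rw [Code.induced_eq, law_law]
  rfl

lemma Code.law_ideal : law (c.ideal q ch) zipEquiv =
    ext (law (c.pmf q ch) spZ) fun _ s => ∏ i, q (s i) := by
  funext ⟨z, s⟩
  rw [law_equiv, ← Code.inducedZ_eq]
  rfl

/-- The law of `(Zⁿ, (X₁, X₂, W, Y)ⁿ)` is close to that of an i.i.d. sequence independent of
`Zⁿ`. -/
lemma Code.tv_spZ_spQ_le :
    tv (law (c.pmf q ch) (pair spZ spQ)) (ext (law (c.pmf q ch) spZ) fun _ s => ∏ i, q (s i)) ≤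
      tv (c.induced q ch) (c.ideal q ch) := by
  rw [← Code.law_ideal, Code.law_spZ_spQ]
  exact tv_law_le _ _ _

end Facts

section Ideal

variable {𝓠 : Type*} [Fintype 𝓠]

lemma hasCond_iid_eval {r : (Fin n → 𝓩) → ℝ} {q : 𝓠 → ℝ} (hq : q ∈ stdSimplex ℝ 𝓠) (i : Fin n) :
    HasCond (ext r fun _ (s : Fin n → 𝓠) => ∏ i, q (s i)) Prod.fst (fun x => x.2 i) fun _ => q := by
  have h := (hasCond_ext r (κ := fun _ (s : Fin n → 𝓠) => ∏ i, q (s i))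
    fun _ => prod_mem_stdSimplex fun _ => hq).map_right fun s => s i
  simp only [law_prod_eval (k := fun _ => q) fun _ => hq.2] at h
  exact h

lemma law_iid_eval {r : (Fin n → 𝓩) → ℝ} (hr : r ∈ stdSimplex ℝ (Fin n → 𝓩)) {q : 𝓠 → ℝ}
    (hq : q ∈ stdSimplex ℝ 𝓠) (i : Fin n) :
    law (ext r fun _ (s : Fin n → 𝓠) => ∏ i, q (s i)) (fun x => x.2 i) = q :=
  (hasCond_iid_eval hq i).law_eq (ext_mem hr fun _ => prod_mem_stdSimplex fun _ => hq)

lemma pmfEntropy_iid {r : (Fin n → 𝓩) → ℝ} (hr : r ∈ stdSimplex ℝ (Fin n → 𝓩)) {q : 𝓠 → ℝ}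
    (hq : q ∈ stdSimplex ℝ 𝓠) :
    pmfEntropy (ext r fun _ (s : Fin n → 𝓠) => ∏ i, q (s i)) = pmfEntropy r + n * pmfEntropy q := by
  have hmem := ext_mem hr (κ := fun _ (s : Fin n → 𝓠) => ∏ i, q (s i))
    fun _ => prod_mem_stdSimplex fun _ => hq
  have h := (hasCond_ext r (κ := fun _ (s : Fin n → 𝓠) => ∏ i, q (s i))
    fun _ => prod_mem_stdSimplex fun _ => hq).ent_prod hmem.1 (k := fun _ : Unit => q)
    (fun _ => hq) fun _ _ => ()
  have h1 : ∀ i, ent (ext r fun _ (s : Fin n → 𝓠) => ∏ i, q (s i))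
      (pair (fun _ => ()) fun x => x.2 i) = pmfEntropy q := by
    intro i
    rw [ent_congr (Y := fun x : (Fin n → 𝓩) × (Fin n → 𝓠) => x.2 i) hmem.1
      fun _ _ => by simp [pair], ent, law_iid_eval hr hq]
  have h2 : ent (ext r fun _ (s : Fin n → 𝓠) => ∏ i, q (s i)) Prod.fst = pmfEntropy r := by
    rw [ent, law_ext_fst _ fun _ => prod_mem_stdSimplex fun _ => hq]
  simp only [h1, ent_const hmem, sub_zero, Finset.sum_const, Finset.card_univ, Fintype.card_fin,
    nsmul_eq_mul, h2] at h
  rw [pmfEntropy_eq_ent_id]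
  change ent _ (pair Prod.fst Prod.snd) = _
  linarith

end Ideal

section Close

variable (c : Code 𝓧₁ 𝓧₂ 𝓦 𝓨 𝓐₁ 𝓐₂ 𝓑 M₁ M₂ n) {q : 𝓧₁ × 𝓧₂ × 𝓦 × 𝓨 → ℝ}
  (hq : q ∈ stdSimplex ℝ (𝓧₁ × 𝓧₂ × 𝓦 × 𝓨)) {ch : 𝓐₁ × 𝓐₂ → 𝓑 × 𝓩 → ℝ}
  (hch : ∀ a, ch a ∈ stdSimplex ℝ (𝓑 × 𝓩)) (hM₁ : 0 < M₁) (hM₂ : 0 < M₂)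

include hq hch hM₁ hM₂ in
lemma Code.tv_letter_le (i : Fin n) :
    tv (law (c.pmf q ch) fun ω => spQ ω i) q ≤ tv (c.induced q ch) (c.ideal q ch) := by
  have h1 := tv_law_le (law (c.pmf q ch) (pair spZ spQ))
    (ext (law (c.pmf q ch) spZ) fun _ s => ∏ i, q (s i)) fun x => x.2 i
  rw [law_iid_eval (law_mem (c.pmf_mem hq hch hM₁ hM₂) _) hq, law_law] at h1
  exact h1.trans (c.tv_spZ_spQ_le)

include hq hch hM₁ hM₂ in
/-- Near-independence of `Zⁿ` and near-i.i.d. behaviour of the coordinated letters, in terms of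
entropy. -/
lemma Code.sum_ent_add_le (hn : 0 < n) {δ : ℝ} (hδ : 0 < δ) (hδ1 : δ ≤ 1)
    (h : tv (c.induced q ch) (c.ideal q ch) ≤ δ) :
    ∑ i, ent (c.pmf q ch) (fun ω => spQ ω i) + ent (c.pmf q ch) spZ ≤
      ent (c.pmf q ch) (pair spZ spQ) +
        n * (modulus (Fintype.card 𝓩 * Fintype.card (𝓧₁ × 𝓧₂ × 𝓦 × 𝓨)) δ +
          modulus (Fintype.card (𝓧₁ × 𝓧₂ × 𝓦 × 𝓨)) δ) := by
  have hp := c.pmf_mem hq hch hM₁ hM₂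
  have hl := Real.log_pos one_lt_two
  have hz := law_mem hp spZ
  have hn1 : (1 : ℝ) ≤ n := by exact_mod_cast hn
  have h1 := pmfEntropy_le_add (law_mem hp (pair spZ spQ))
    (ext_mem hz fun _ => prod_mem_stdSimplex (ι := Fin n) fun _ => hq) hδ hδ1
    ((c.tv_spZ_spQ_le).trans h)
  have h2 : ∀ i, ent (c.pmf q ch) (fun ω => spQ ω i) ≤ pmfEntropy q +
      modulus (Fintype.card (𝓧₁ × 𝓧₂ × 𝓦 × 𝓨)) δ := fun i =>
    pmfEntropy_le_add hq (law_mem hp _) hδ hδ1 (by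
      have := c.tv_letter_le hq hch hM₁ hM₂ i
      rw [tv] at this ⊢
      simp only [abs_sub_comm (q _)]
      exact this.trans h)
  have h3 := Finset.sum_le_sum fun i (_ : i ∈ Finset.univ) => h2 i
  rw [Finset.sum_const, Finset.card_univ, Fintype.card_fin, nsmul_eq_mul] at h3
  rw [pmfEntropy_iid hz hq] at h1
  have hcard : Real.logb 2 (Fintype.card ((Fin n → 𝓩) × (Fin n → 𝓧₁ × 𝓧₂ × 𝓦 × 𝓨))) =
      n * Real.logb 2 (Fintype.card 𝓩 * Fintype.card (𝓧₁ × 𝓧₂ × 𝓦 × 𝓨)) := by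
    rw [Fintype.card_prod, Fintype.card_fun, Fintype.card_fun, Fintype.card_fin, ← mul_pow]
    push_cast
    rw [Real.logb_pow]
  have h4 : 0 ≤ δ * Real.logb 2 δ⁻¹ + 2 * δ / Real.log 2 :=
    add_nonneg (mul_nonneg hδ.le (Real.logb_nonneg one_lt_two ((one_le_inv₀ hδ).2 hδ1)))
      (by positivity)
  have h5 := mul_le_mul_of_nonneg_right hn1 h4
  have h6 : ent (c.pmf q ch) (pair spZ spQ) = pmfEntropy (law (c.pmf q ch) (pair spZ spQ)) := rfl
  have h7 : ent (c.pmf q ch) spZ = pmfEntropy (law (c.pmf q ch) spZ) := rfl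
  unfold modulus at *
  rw [hcard] at h1
  rw [h6, h7]
  linarith

end Close

end Code

/-! ### Bounds for the letters of a code -/

section Letter

variable {Ω α β γ δ ζ θ : Type*} [Fintype Ω] [Fintype α] [Fintype β] [Fintype γ] [Fintype δ]
  [Fintype ζ] [Fintype θ]

/-- If `U`, `V`, `G` are determined by the knowledge `Q` of the decoder, then
`I(U; F | V, G) ≤ H(F | G) - H(F | Q)`. -/
lemma condMI_le {p : Ω → ℝ} (hp : ∀ ω, 0 ≤ p ω) {U : Ω → α} {F : Ω → β} {V : Ω → γ} {G : Ω → δ}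
    {S : Ω → ζ} {Q : Ω → θ} (hQ : (pair U (pair V G)).FactorsThrough Q)
    (hS : ∀ ω ω', S ω = S ω' ↔ F ω = F ω' ∧ G ω = G ω') :
    condMI p U F (pair V G) ≤ ent p S - ent p G - (ent p (pair F Q) - ent p Q) := by
  have e1 := ent_submodular hp (A := S) (B := pair V G) (C := pair F (pair V G)) (D := G)
    (fun ω ω' h => by simp_all [pair]) (fun ω ω' h => ((hS ω ω').1 h).2)
    (fun ω ω' h => by simp_all [pair])
  have e2 := ent_submodular hp (A := pair U (pair F (pair V G))) (B := Q) (C := pair F Q)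
    (D := pair U (pair V G)) (fun ω ω' h => by simp_all [pair]) (fun ω ω' h => by simp_all [pair]) hQ
  rw [condMI_eq hp]
  linarith

end Letter

section CodeBounds

variable {𝓧₁ 𝓧₂ 𝓦 𝓨 𝓐₁ 𝓐₂ 𝓑 𝓩 : Type*} [Fintype 𝓧₁] [Fintype 𝓧₂] [Fintype 𝓦] [Fintype 𝓨]
  [Fintype 𝓐₁] [Fintype 𝓐₂] [Fintype 𝓑] [Fintype 𝓩] {M₁ M₂ n : ℕ}

/-- The side information `Wⁿ`. -/
def spW (ω : Space 𝓧₁ 𝓧₂ 𝓦 𝓨 𝓐₁ 𝓐₂ 𝓑 𝓩 M₁ M₂ n) : Fin n → 𝓦 := fun i => (spS ω i).2.2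

variable (c : Code 𝓧₁ 𝓧₂ 𝓦 𝓨 𝓐₁ 𝓐₂ 𝓑 M₁ M₂ n) {q : 𝓧₁ × 𝓧₂ × 𝓦 × 𝓨 → ℝ}
  (hq : q ∈ stdSimplex ℝ (𝓧₁ × 𝓧₂ × 𝓦 × 𝓨)) {ch : 𝓐₁ × 𝓐₂ → 𝓑 × 𝓩 → ℝ}
  (hch : ∀ a, ch a ∈ stdSimplex ℝ (𝓑 × 𝓩)) (hM₁ : 0 < M₁) (hM₂ : 0 < M₂)

include hq hch hM₁ hM₂

lemma Code.ent_spS : ent (c.pmf q ch) spS = ∑ i, ent (c.pmf q ch) fun ω => spS ω i := by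
  have hp := c.pmf_mem hq hch hM₁ hM₂
  have h := hasCond_unit hp spS
  rw [c.law_spS hch hM₁ hM₂] at h
  have h1 := h.ent_prod hp.1 (k := fun _ : Unit => srcLaw q) (fun _ => srcLaw_mem hq) fun _ _ => ()
  simp only [ent_const hp, sub_zero] at h1
  have h2 : ent (c.pmf q ch) (pair (fun _ => ()) spS) = ent (c.pmf q ch) spS :=
    ent_congr hp.1 fun _ _ => by simp [pair]
  have h3 : ∀ i, ent (c.pmf q ch) (pair (fun _ => ()) fun ω => spS ω i) =
      ent (c.pmf q ch) fun ω => spS ω i := fun i => ent_congr hp.1 fun _ _ => by simp [pair]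
  simpa only [h2, h3] using h1

lemma Code.ent_spS_spK :
    ent (c.pmf q ch) (pair spS spK) = ent (c.pmf q ch) spS + ent (c.pmf q ch) spK := by
  have hp := c.pmf_mem hq hch hM₁ hM₂
  have h := (c.hasCond_spK (q := q) hch hM₁ hM₂).ent_map_left hp.1 (fun _ => ())
    (κ := fun _ _ => 1 / ((M₁ : ℝ) * (M₂ : ℝ)))
  have h2 : ent (c.pmf q ch) (pair (fun _ => ()) spK) = ent (c.pmf q ch) spK :=
    ent_congr hp.1 fun _ _ => by simp [pair]
  rw [ent_const hp, h2] at h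
  linarith

lemma Code.ent_spO : ent (c.pmf q ch) (pair (pair (pair spS spK) spA) (pair spB spZ)) -
      ent (c.pmf q ch) (pair (pair spS spK) spA) =
    ∑ i, (ent (c.pmf q ch) (pair (fun ω => spA ω i) (pair (fun ω => spB ω i) fun ω => spZ ω i)) -
      ent (c.pmf q ch) fun ω => spA ω i) := by
  have hp := c.pmf_mem hq hch hM₁ hM₂
  have h := (c.hasCond_spO (q := q) hch).ent_prod hp.1 hch
    (fun v : ((Fin n → 𝓧₁ × 𝓧₂ × 𝓦) × (Fin M₁ × Fin M₂)) × (Fin n → 𝓐₁ × 𝓐₂) => v.2)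
  have h1 : ent (c.pmf q ch) (pair (pair (pair spS spK) spA) (pair spB spZ)) =
      ent (c.pmf q ch) (pair (pair (pair spS spK) spA) spO) := ent_congr hp.1 fun ω ω' => by
    simp only [pair, Prod.mk.injEq, spB, spZ, funext_iff, Prod.ext_iff (x := spO ω _), forall_and]
  rw [h1]
  exact h

/-- Given `(X₂, W)ⁿ` and the keys, the second channel input does not depend on `X₁ⁿ`. -/
lemma Code.ent_input₂ : ent (c.pmf q ch) (pair (fun ω i => (spA ω i).2)
        (pair (fun ω i => (spS ω i).2) spK)) -
      ent (c.pmf q ch) (pair (fun ω i => (spS ω i).2) spK) ≤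
    ent (c.pmf q ch) (pair (fun ω i => (spA ω i).2) (pair spS spK)) -
      ent (c.pmf q ch) (pair spS spK) := by
  have hp := c.pmf_mem hq hch hM₁ hM₂
  have h := (c.hasCond_spA (q := q) hch).map_right fun a i => (a i).2
  have h1 : ∀ v, law (c.encKernel v) (fun a i => (a i).2) =
      c.enc₂ (fun i => (v.1 i).2.1) v.2.2 := by
    intro v
    funext a₂
    have := law_equiv_fst (c.encKernel v) ((Equiv.arrowProdEquivProdArrow (Fin n) (fun _ => 𝓐₁)
      fun _ => 𝓐₂).trans (Equiv.prodComm _ _)) a₂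
    refine this.trans ?_
    change ∑ a₁, c.enc₁ (fun i => (v.1 i).1) v.2.1 a₁ *
      c.enc₂ (fun i => (v.1 i).2.1) v.2.2 a₂ = _
    rw [← Finset.sum_mul, (c.enc₁_mem _ _).2, one_mul]
  simp only [h1] at h
  have h2 := h.ent_map_left hp.1
    (fun v : (Fin n → 𝓧₁ × 𝓧₂ × 𝓦) × (Fin M₁ × Fin M₂) => (fun i => (v.1 i).2, v.2))
    (κ := fun v : (Fin n → 𝓧₂ × 𝓦) × (Fin M₁ × Fin M₂) => c.enc₂ (fun i => (v.1 i).1) v.2.2)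
  have h3 : ent (c.pmf q ch) (pair (pair spS spK) fun ω i => (spA ω i).2) =
      ent (c.pmf q ch) (pair (fun ω i => (spA ω i).2) (pair spS spK)) :=
    ent_congr hp.1 fun _ _ => by simp only [pair, Prod.mk.injEq]; tauto
  have h4 : ent (c.pmf q ch) (pair (pair (fun ω i => (spS ω i).2) spK) fun ω i => (spA ω i).2) =
      ent (c.pmf q ch) (pair (fun ω i => (spA ω i).2) (pair (fun ω i => (spS ω i).2) spK)) :=
    ent_congr hp.1 fun _ _ => by simp only [pair, Prod.mk.injEq]; tauto
  rw [← h3, ← h4]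
  exact h2.ge

/-- Given `(X₁, W)ⁿ` and the keys, the first channel input does not depend on `X₂ⁿ`. -/
lemma Code.ent_input₁ : ent (c.pmf q ch) (pair (fun ω i => (spA ω i).1)
        (pair (fun ω i => ((spS ω i).1, (spS ω i).2.2)) spK)) -
      ent (c.pmf q ch) (pair (fun ω i => ((spS ω i).1, (spS ω i).2.2)) spK) ≤
    ent (c.pmf q ch) (pair (fun ω i => (spA ω i).1) (pair spS spK)) -
      ent (c.pmf q ch) (pair spS spK) := by
  have hp := c.pmf_mem hq hch hM₁ hM₂
  have h := (c.hasCond_spA (q := q) hch).map_right fun a i => (a i).1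
  have h1 : ∀ v, law (c.encKernel v) (fun a i => (a i).1) =
      c.enc₁ (fun i => (v.1 i).1) v.2.1 := by
    intro v
    funext a₁
    have := law_equiv_fst (c.encKernel v)
      (Equiv.arrowProdEquivProdArrow (Fin n) (fun _ => 𝓐₁) fun _ => 𝓐₂) a₁
    refine this.trans ?_
    change ∑ a₂, c.enc₁ (fun i => (v.1 i).1) v.2.1 a₁ *
      c.enc₂ (fun i => (v.1 i).2.1) v.2.2 a₂ = _
    rw [← Finset.mul_sum, (c.enc₂_mem _ _).2, mul_one]
  simp only [h1] at h
  have h2 := h.ent_map_left hp.1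
    (fun v : (Fin n → 𝓧₁ × 𝓧₂ × 𝓦) × (Fin M₁ × Fin M₂) =>
      (fun i => ((v.1 i).1, (v.1 i).2.2), v.2))
    (κ := fun v : (Fin n → 𝓧₁ × 𝓦) × (Fin M₁ × Fin M₂) => c.enc₁ (fun i => (v.1 i).1) v.2.1)
  have h3 : ent (c.pmf q ch) (pair (pair spS spK) fun ω i => (spA ω i).1) =
      ent (c.pmf q ch) (pair (fun ω i => (spA ω i).1) (pair spS spK)) :=
    ent_congr hp.1 fun _ _ => by simp only [pair, Prod.mk.injEq]; tauto
  have h4 : ent (c.pmf q ch) (pair (pair (fun ω i => ((spS ω i).1, (spS ω i).2.2)) spK)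
      fun ω i => (spA ω i).1) = ent (c.pmf q ch) (pair (fun ω i => (spA ω i).1)
        (pair (fun ω i => ((spS ω i).1, (spS ω i).2.2)) spK)) :=
    ent_congr hp.1 fun _ _ => by simp only [pair, Prod.mk.injEq]; tauto
  rw [← h3, ← h4]
  exact h2.ge

variable {𝓤₁ 𝓤₂ : Type*} [Fintype 𝓤₁] [Fintype 𝓤₂]
  {U₁ : Fin n → Space 𝓧₁ 𝓧₂ 𝓦 𝓨 𝓐₁ 𝓐₂ 𝓑 𝓩 M₁ M₂ n → 𝓤₁}
  {U₂ : Fin n → Space 𝓧₁ 𝓧₂ 𝓦 𝓨 𝓐₁ 𝓐₂ 𝓑 𝓩 M₁ M₂ n → 𝓤₂}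

/-- The channel bound for the first source, the second user being known to the receiver. -/
lemma Code.sum_condMI_le₁
    (hU₁ : ∀ i, (U₁ i).FactorsThrough (pair (fun ω => (spK ω).1) (pair spB spW)))
    (hU₂ : ∀ i, (U₂ i).FactorsThrough (pair (fun ω => (spK ω).2) (pair spB spW))) :
    ∑ i, condMI (c.pmf q ch) (U₁ i) (fun ω => (spS ω i).1) (pair (U₂ i) fun ω => (spS ω i).2) ≤
      ∑ i, condMI (c.pmf q ch) (fun ω => (spA ω i).1) (fun ω => spB ω i)
        fun ω => (spA ω i).2 := by
  have hp := c.pmf_mem hq hch hM₁ hM₂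
  refine le_trans (Finset.sum_le_sum fun i _ => ?_)
    ((cutset_bound hp spS spK spA spB spZ (fun s => s.1) (fun s => s.2) (fun a => a.2)
      (fun s s' h h' => Prod.ext h h') (c.ent_spS hq hch hM₁ hM₂) (c.ent_spS_spK hq hch hM₁ hM₂)
      (c.ent_input₂ hq hch hM₁ hM₂) (c.ent_spO hq hch hM₁ hM₂)).trans
      (Finset.sum_le_sum fun i _ => ?_))
  · refine condMI_le hp.1 (fun ω ω' h => ?_) fun ω ω' => Prod.ext_iff
    simp only [pair, Prod.mk.injEq, funext_iff] at h ⊢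
    exact ⟨hU₁ i (by simp [pair, spW, funext_iff, h]), hU₂ i (by simp [pair, spW, funext_iff, h]),
      h.2 i⟩
  · rw [condMI_eq hp.1]
    refine le_of_eq ?_
    have h1 : ent (c.pmf q ch) (pair (fun ω => (spA ω i).1) fun ω => (spA ω i).2) =
      ent (c.pmf q ch) fun ω => spA ω i := rfl
    have h2 : ent (c.pmf q ch) (pair (fun ω => (spA ω i).1)
        (pair (fun ω => spB ω i) fun ω => (spA ω i).2)) =
      ent (c.pmf q ch) (pair (fun ω => spA ω i) fun ω => spB ω i) := ent_congr hp.1 fun ω ω' => by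
        simp only [pair, Prod.mk.injEq, Prod.ext_iff (x := spA ω i)]; tauto
    rw [h1, h2]
    ring

/-- The channel bound for the second source, the first user being known to the receiver. -/
lemma Code.sum_condMI_le₂
    (hU₁ : ∀ i, (U₁ i).FactorsThrough (pair (fun ω => (spK ω).1) (pair spB spW)))
    (hU₂ : ∀ i, (U₂ i).FactorsThrough (pair (fun ω => (spK ω).2) (pair spB spW))) :
    ∑ i, condMI (c.pmf q ch) (U₂ i) (fun ω => (spS ω i).2.1)
        (pair (U₁ i) fun ω => ((spS ω i).1, (spS ω i).2.2)) ≤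
      ∑ i, condMI (c.pmf q ch) (fun ω => (spA ω i).2) (fun ω => spB ω i)
        fun ω => (spA ω i).1 := by
  have hp := c.pmf_mem hq hch hM₁ hM₂
  refine le_trans (Finset.sum_le_sum fun i _ => ?_)
    ((cutset_bound hp spS spK spA spB spZ (fun s => s.2.1) (fun s => (s.1, s.2.2)) (fun a => a.1)
      (fun s s' h h' => by simp only [Prod.ext_iff] at *; tauto)
      (c.ent_spS hq hch hM₁ hM₂) (c.ent_spS_spK hq hch hM₁ hM₂)
      (c.ent_input₁ hq hch hM₁ hM₂) (c.ent_spO hq hch hM₁ hM₂)).trans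
      (Finset.sum_le_sum fun i _ => ?_))
  · refine condMI_le hp.1 (fun ω ω' h => ?_) fun ω ω' => by
      simp only [Prod.ext_iff]; tauto
    simp only [pair, Prod.mk.injEq, funext_iff] at h ⊢
    exact ⟨hU₂ i (by simp [pair, spW, funext_iff, h]), hU₁ i (by simp [pair, spW, funext_iff, h]),
      h.2 i⟩
  · rw [condMI_eq hp.1]
    refine le_of_eq ?_
    have h1 : ent (c.pmf q ch) (pair (fun ω => (spA ω i).2) fun ω => (spA ω i).1) =
      ent (c.pmf q ch) fun ω => spA ω i := ent_congr hp.1 fun ω ω' => by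
        simp only [pair, Prod.mk.injEq, Prod.ext_iff (x := spA ω i)]; tauto
    have h2 : ent (c.pmf q ch) (pair (fun ω => (spA ω i).2)
        (pair (fun ω => spB ω i) fun ω => (spA ω i).1)) =
      ent (c.pmf q ch) (pair (fun ω => spA ω i) fun ω => spB ω i) := ent_congr hp.1 fun ω ω' => by
        simp only [pair, Prod.mk.injEq, Prod.ext_iff (x := spA ω i)]; tauto
    rw [h1, h2]
    ring

/-- The channel bound for both sources. -/
lemma Code.sum_condMI_le₁₂
    (hU₁ : ∀ i, (U₁ i).FactorsThrough (pair (fun ω => (spK ω).1) (pair spB spW)))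
    (hU₂ : ∀ i, (U₂ i).FactorsThrough (pair (fun ω => (spK ω).2) (pair spB spW))) :
    ∑ i, condMI (c.pmf q ch) (pair (U₁ i) (U₂ i)) (fun ω => ((spS ω i).1, (spS ω i).2.1))
        (fun ω => spW ω i) ≤
      ∑ i, condMI (c.pmf q ch) (fun ω => spA ω i) (fun ω => spB ω i) fun _ => () := by
  have hp := c.pmf_mem hq hch hM₁ hM₂
  refine le_trans (Finset.sum_le_sum fun i _ => ?_)
    ((cutset_bound hp spS spK spA spB spZ (fun s => (s.1, s.2.1)) (fun s => s.2.2) (fun _ => ())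
      (fun s s' h h' => by simp only [Prod.ext_iff] at *; tauto)
      (c.ent_spS hq hch hM₁ hM₂) (c.ent_spS_spK hq hch hM₁ hM₂) (le_of_eq ?_)
      (c.ent_spO hq hch hM₁ hM₂)).trans (Finset.sum_le_sum fun i _ => ?_))
  · have h := condMI_le hp.1 (U := pair (U₁ i) (U₂ i))
      (F := fun ω => ((spS ω i).1, (spS ω i).2.1)) (V := fun _ => ()) (G := fun ω => spW ω i)
      (S := fun ω => spS ω i) (Q := pair (pair spK spB) fun ω i => (spS ω i).2.2)
      (fun ω ω' h => by
        simp only [pair, Prod.mk.injEq, funext_iff] at h ⊢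
        exact ⟨⟨hU₁ i (by simp [pair, spW, funext_iff, h]),
          hU₂ i (by simp [pair, spW, funext_iff, h])⟩, trivial, h.2 i⟩)
      (fun ω ω' => by simp only [Prod.ext_iff, spW]; tauto)
    refine le_trans (le_of_eq ?_) h
    rw [condMI_eq hp.1, condMI_eq hp.1]
    congr 1 <;> congr 1 <;> exact ent_congr hp.1 fun _ _ => by simp [pair]
  · have h1 : ent (c.pmf q ch) (pair (fun _ (_ : Fin n) => ()) (pair (fun ω i => (spS ω i).2.2) spK))
        = ent (c.pmf q ch) (pair (fun ω i => (spS ω i).2.2) spK) :=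
      ent_congr hp.1 fun _ _ => by simp [pair]
    have h2 : ent (c.pmf q ch) (pair (fun _ (_ : Fin n) => ()) (pair spS spK)) =
        ent (c.pmf q ch) (pair spS spK) := ent_congr hp.1 fun _ _ => by simp [pair]
    rw [h1, h2, sub_self, sub_self]
  · rw [condMI_eq hp.1]
    refine le_of_eq ?_
    have h1 : ent (c.pmf q ch) (pair (fun ω => spA ω i) fun _ => ()) =
      ent (c.pmf q ch) fun ω => spA ω i := ent_congr hp.1 fun ω ω' => by simp [pair]
    have h2 : ent (c.pmf q ch) (pair (fun ω => spA ω i) (pair (fun ω => spB ω i) fun _ => ())) =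
      ent (c.pmf q ch) (pair (fun ω => spA ω i) fun ω => spB ω i) :=
        ent_congr hp.1 fun ω ω' => by simp [pair]
    rw [h1, h2]
    ring

/-- The key rate bound in terms of the letters, for the part `J = j(K)` of the keys. -/
lemma Code.sum_sub_le_ent_key (hn : 0 < n) {δ : ℝ} (hδ : 0 < δ) (hδ1 : δ ≤ 1)
    (h : tv (c.induced q ch) (c.ideal q ch) ≤ δ) {κ 𝓤 : Type*} [Fintype κ] [Fintype 𝓤]
    (j : Fin M₁ × Fin M₂ → κ) {U : Fin n → Space 𝓧₁ 𝓧₂ 𝓦 𝓨 𝓐₁ 𝓐₂ 𝓑 𝓩 M₁ M₂ n → 𝓤}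
    (hU : ∀ i, (U i).FactorsThrough (pair (fun ω => j (spK ω)) (pair spB spW))) :
    ∑ i, (condMI (c.pmf q ch) (U i) (fun ω => ((spS ω i).1, (spS ω i).2.1, spY ω i))
          (fun ω => spW ω i) -
        condEntropy (c.pmf q ch) (fun ω => spY ω i) (fun ω => spS ω i) -
        condMI (c.pmf q ch) (fun ω => spA ω i) (fun ω => spB ω i) fun ω => spZ ω i) ≤
      ent (c.pmf q ch) (fun ω => j (spK ω)) +
        n * (modulus (Fintype.card 𝓩 * Fintype.card (𝓧₁ × 𝓧₂ × 𝓦 × 𝓨)) δ +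
          modulus (Fintype.card (𝓧₁ × 𝓧₂ × 𝓦 × 𝓨)) δ) := by
  have hp := c.pmf_mem hq hch hM₁ hM₂
  have h0 := hp.1
  have hc := c.sum_ent_add_le hq hch hM₁ hM₂ hn hδ hδ1 h
  have hw := ent_pi_le_sum hp (spW : Space 𝓧₁ 𝓧₂ 𝓦 𝓨 𝓐₁ 𝓐₂ 𝓑 𝓩 M₁ M₂ n → _)
  set X : Space 𝓧₁ 𝓧₂ 𝓦 𝓨 𝓐₁ 𝓐₂ 𝓑 𝓩 M₁ M₂ n → Fin n → 𝓧₁ × 𝓧₂ :=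
    fun ω i => ((spS ω i).1, (spS ω i).2.1) with hX
  set J : Space 𝓧₁ 𝓧₂ 𝓦 𝓨 𝓐₁ 𝓐₂ 𝓑 𝓩 M₁ M₂ n → κ := fun ω => j (spK ω) with hJ
  have hSX : ∀ ω ω' : Space 𝓧₁ 𝓧₂ 𝓦 𝓨 𝓐₁ 𝓐₂ 𝓑 𝓩 M₁ M₂ n, ∀ i,
      spS ω i = spS ω' i ↔ X ω i = X ω' i ∧ spW ω i = spW ω' i := fun ω ω' i => by
    simp only [hX, spW, Prod.ext_iff]; tauto
  have hSX' : ∀ ω ω' : Space 𝓧₁ 𝓧₂ 𝓦 𝓨 𝓐₁ 𝓐₂ 𝓑 𝓩 M₁ M₂ n,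
      spS ω = spS ω' ↔ X ω = X ω' ∧ spW ω = spW ω' := fun ω ω' => by
    simp only [funext_iff, hSX, forall_and]
  have hO := c.ent_spO hq hch hM₁ hM₂
  have hO2 := ent_submodular h0 (A := pair (pair (pair (pair X spW) J) spA) (pair spB spZ))
    (B := pair (pair spS spK) spA) (C := pair (pair (pair spS spK) spA) (pair spB spZ))
    (D := pair (pair (pair X spW) J) spA)
    (fun ω ω' h => by
      simp only [pair, Prod.mk.injEq] at h ⊢
      exact ⟨h.2, h.1.2⟩)
    (fun ω ω' h => congrArg Prod.fst h)
    (fun ω ω' h => by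
      simp only [pair, Prod.mk.injEq] at h ⊢
      exact ⟨⟨(hSX' _ _).1 h.1.1, congrArg j h.1.2⟩, h.2⟩)
  have hk := key_bound hp X spW J spA spB spZ spY (by linarith)
  have hQ : ent (c.pmf q ch) (pair spZ spQ) =
      ent (c.pmf q ch) (pair (pair X spW) (pair spY spZ)) := ent_congr h0 fun ω ω' => by
    simp only [pair, Prod.mk.injEq, spQ, funext_iff, hX, spW, forall_and]; tauto
  have e1 : ∀ i, condMI (c.pmf q ch) (U i) (fun ω => ((spS ω i).1, (spS ω i).2.1, spY ω i))
      (fun ω => spW ω i) ≤ ent (c.pmf q ch) (fun ω => spQ ω i) - ent (c.pmf q ch) (fun ω => spW ω i)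
      - (ent (c.pmf q ch) (pair (pair (fun ω => X ω i) fun ω => spY ω i) (pair (pair J spB) spW)) -
        ent (c.pmf q ch) (pair (pair J spB) spW)) := by
    intro i
    have e := ent_submodular h0 (A := pair (U i) (pair (fun ω => ((spS ω i).1, (spS ω i).2.1,
      spY ω i)) fun ω => spW ω i)) (B := pair (pair J spB) spW)
      (C := pair (pair (fun ω => X ω i) fun ω => spY ω i) (pair (pair J spB) spW))
      (D := pair (U i) fun ω => spW ω i)
      (fun ω ω' h => by
        simp only [pair, Prod.mk.injEq, hX] at h ⊢
        tauto)
      (fun ω ω' h => by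
        simp only [pair, Prod.mk.injEq] at h ⊢
        exact ⟨h.1, h.2.2⟩)
      (fun ω ω' h => by
        simp only [pair, Prod.mk.injEq] at h ⊢
        exact ⟨hU i (by simp only [pair, Prod.mk.injEq]; exact ⟨h.1.1, h.1.2, h.2⟩), by rw [h.2]⟩)
    have e' : ent (c.pmf q ch) (pair (fun ω => ((spS ω i).1, (spS ω i).2.1, spY ω i))
        fun ω => spW ω i) = ent (c.pmf q ch) fun ω => spQ ω i := ent_congr h0 fun ω ω' => by
      simp only [pair, Prod.mk.injEq, spQ, spW]; tauto
    rw [condMI_eq h0]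
    linarith
  have e2 : ∀ i, condEntropy (c.pmf q ch) (fun ω => spY ω i) (fun ω => spS ω i) =
      ent (c.pmf q ch) (pair (fun ω => spY ω i) (pair (fun ω => X ω i) fun ω => spW ω i)) -
        ent (c.pmf q ch) (pair (fun ω => X ω i) fun ω => spW ω i) := by
    intro i
    rw [condEntropy_eq h0]
    congr 1 <;> exact ent_congr h0 fun ω ω' => by simp only [pair, Prod.mk.injEq, hSX]
  have e3 : ∀ i, condMI (c.pmf q ch) (fun ω => spA ω i) (fun ω => spB ω i) (fun ω => spZ ω i) =
      ent (c.pmf q ch) (pair (fun ω => spB ω i) fun ω => spZ ω i) -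
        ent (c.pmf q ch) (fun ω => spZ ω i) -
        (ent (c.pmf q ch) (pair (fun ω => spA ω i) (pair (fun ω => spB ω i) fun ω => spZ ω i)) -
          ent (c.pmf q ch) (pair (fun ω => spA ω i) fun ω => spZ ω i)) := by
    intro i
    rw [condMI_eq h0]
    ring
  have e4 := Finset.sum_le_sum fun i (_ : i ∈ Finset.univ) => e1 i
  simp only [e2, e3]
  simp only [Finset.sum_sub_distrib] at *
  linarith

end CodeBounds

/-! ### Uniform mixtures over a time-sharing variable -/

section Mixture

variable {Ω Ω' α β γ δ ζ : Type*} [Fintype Ω] [Fintype Ω'] [Fintype α] [Fintype β] [Fintype γ]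
  [Fintype δ] [Fintype ζ] {n : ℕ}

/-- Under `p'`, the variable `T` is uniform on `Fin n`, and given `T = t` the variable `D` has the
law of `E t` under `p`. -/
def IsMixture (p' : Ω' → ℝ) (D : Ω' → δ) (T : Ω' → Fin n) (p : Ω → ℝ) (E : Fin n → Ω → δ) : Prop :=
  ∀ d t, law p' (pair D T) (d, t) = (1 / n) * law p (E t) d

omit [Fintype α] in
lemma IsMixture.map {p' : Ω' → ℝ} {D : Ω' → δ} {T : Ω' → Fin n} {p : Ω → ℝ} {E : Fin n → Ω → δ}
    (h : IsMixture p' D T p E) (φ : δ → α) :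
    IsMixture p' (fun ω => φ (D ω)) T p fun t ω => φ (E t ω) := by
  classical
  intro a t
  have h1 : law p' (pair (fun ω => φ (D ω)) T) = law (law p' (pair D T)) fun d => (φ d.1, d.2) := by
    rw [law_law]; rfl
  rw [h1, ← law_law p (E t) φ]
  have h2 : ∀ d, (1 / n : ℝ) * law p (E t) d = law p' (pair D T) (d, t) := fun d => (h d t).symm
  generalize law p' (pair D T) = r at *
  generalize law p (E t) = s at *
  unfold law
  rw [Fintype.sum_prod_type, Finset.mul_sum]
  refine Finset.sum_congr rfl fun d _ => ?_
  rw [Finset.sum_eq_single t]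
  · by_cases hd : φ d = a
    · simpa [hd] using (h2 d).symm
    · simp [hd]
  · intro t' _ ht
    simp [ht]
  · simp

/-- `H(D, T) = log n + H(D | T)`, the conditional entropy being the average over `t`. -/
lemma IsMixture.ent_eq {p' : Ω' → ℝ} {D : Ω' → δ} {T : Ω' → Fin n} {p : Ω → ℝ}
    (hp : p ∈ stdSimplex ℝ Ω) {E : Fin n → Ω → δ} (hn : 0 < n) (h : IsMixture p' D T p E) :
    ent p' (pair D T) = Real.logb 2 n + (1 / n) * ∑ t, ent p (E t) := by
  have hn' : (n : ℝ) ≠ 0 := by exact_mod_cast hn.ne'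
  have key : ∀ d t, law p' (pair D T) (d, t) * Real.logb 2 (law p' (pair D T) (d, t)) =
      (1 / n) * (law p (E t) d * Real.logb 2 (law p (E t) d) -
        law p (E t) d * Real.logb 2 n) := by
    intro d t
    rw [h d t]
    by_cases h0 : law p (E t) d = 0
    · simp [h0]
    · rw [Real.logb_mul (one_div_ne_zero hn') h0, one_div, Real.logb_inv]
      ring
  have hsum : ∀ t, ∑ d, law p (E t) d = 1 := fun t => (sum_law p (E t)).trans hp.2
  simp only [ent, pmfEntropy]
  rw [Fintype.sum_prod_type_right]
  simp only [key, ← Finset.mul_sum, Finset.sum_sub_distrib, ← Finset.sum_mul, hsum, one_mul,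
    Finset.sum_const, Finset.card_univ, Fintype.card_fin, nsmul_eq_mul, Finset.sum_neg_distrib]
  field_simp
  ring

lemma IsMixture.condEntropy_eq {p' : Ω' → ℝ} (hp' : ∀ ω, 0 ≤ p' ω) {D : Ω' → δ} {T : Ω' → Fin n}
    {p : Ω → ℝ} (hp : p ∈ stdSimplex ℝ Ω) {E : Fin n → Ω → δ} (hn : 0 < n)
    (h : IsMixture p' D T p E) (φ : δ → α) (χ : δ → γ) {C : Ω' → ζ}
    (hC : ∀ ω ω', C ω = C ω' ↔ χ (D ω) = χ (D ω') ∧ T ω = T ω') :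
    condEntropy p' (fun ω => φ (D ω)) C =
      (1 / n) * ∑ t, condEntropy p (fun ω => φ (E t ω)) fun ω => χ (E t ω) := by
  have h1 : ent p' (pair (fun ω => φ (D ω)) C) = ent p' (pair (fun ω => (φ (D ω), χ (D ω))) T) :=
    ent_congr hp' fun ω ω' => by simp only [pair, Prod.mk.injEq, hC, and_assoc]
  have h2 : ent p' C = ent p' (pair (fun ω => χ (D ω)) T) :=
    ent_congr hp' fun ω ω' => by simp only [pair, Prod.mk.injEq, hC]
  rw [Coordination.condEntropy_eq hp', h1, h2, (h.map fun d => (φ d, χ d)).ent_eq hp hn,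
    (h.map χ).ent_eq hp hn]
  have h3 : ∀ t, condEntropy p (fun ω => φ (E t ω)) (fun ω => χ (E t ω)) =
      ent p (fun ω => (φ (E t ω), χ (E t ω))) - ent p fun ω => χ (E t ω) :=
    fun t => Coordination.condEntropy_eq hp.1 _ _
  simp only [h3, Finset.sum_sub_distrib]
  ring

lemma IsMixture.condMI_eq {p' : Ω' → ℝ} (hp' : ∀ ω, 0 ≤ p' ω) {D : Ω' → δ} {T : Ω' → Fin n}
    {p : Ω → ℝ} (hp : p ∈ stdSimplex ℝ Ω) {E : Fin n → Ω → δ} (hn : 0 < n)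
    (h : IsMixture p' D T p E) (φ : δ → α) (ψ : δ → β) (χ : δ → γ) {C : Ω' → ζ}
    (hC : ∀ ω ω', C ω = C ω' ↔ χ (D ω) = χ (D ω') ∧ T ω = T ω') :
    condMI p' (fun ω => φ (D ω)) (fun ω => ψ (D ω)) C =
      (1 / n) * ∑ t, condMI p (fun ω => φ (E t ω)) (fun ω => ψ (E t ω)) fun ω => χ (E t ω) := by
  unfold condMI
  rw [h.condEntropy_eq hp' hp hn φ χ hC, h.condEntropy_eq hp' hp hn φ (fun d => (ψ d, χ d))
    fun ω ω' => by simp only [Prod.mk.injEq, hC, and_assoc], Finset.sum_sub_distrib, mul_sub]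

end Mixture

/-! ### The auxiliary variables of a code -/

section AuxiliaryOfCode

variable {𝓧₁ 𝓧₂ 𝓦 𝓨 𝓐₁ 𝓐₂ 𝓑 𝓩 : Type*} [Fintype 𝓧₁] [Fintype 𝓧₂] [Fintype 𝓦] [Fintype 𝓨]
  [Fintype 𝓐₁] [Fintype 𝓐₂] [Fintype 𝓑] [Fintype 𝓩] {M₁ M₂ n : ℕ}

/-- The conditional law of keys, channel inputs and channel outputs given the source letters. -/
def Code.noiseKernel (c : Code 𝓧₁ 𝓧₂ 𝓦 𝓨 𝓐₁ 𝓐₂ 𝓑 M₁ M₂ n) (ch : 𝓐₁ × 𝓐₂ → 𝓑 × 𝓩 → ℝ)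
    (s : Fin n → 𝓧₁ × 𝓧₂ × 𝓦) :
    ((Fin M₁ × Fin M₂) × (Fin n → 𝓐₁ × 𝓐₂)) × (Fin n → 𝓑 × 𝓩) → ℝ :=
  ext (ext (fun _ => 1 / ((M₁ : ℝ) * (M₂ : ℝ))) fun k => c.encKernel (s, k))
    fun v o => ∏ i, ch (v.2 i) (o i)

/-- The law of the source letters other than the one at position `i`, which is replaced by `s₀`. -/
def maskLaw (q : 𝓧₁ × 𝓧₂ × 𝓦 × 𝓨 → ℝ) (s₀ : 𝓧₁ × 𝓧₂ × 𝓦) (i : Fin n)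
    (s : Fin n → 𝓧₁ × 𝓧₂ × 𝓦) : ℝ :=
  open Classical in ∏ j, (if j = i then Pi.single s₀ 1 else srcLaw q) (s j)

/-- The alphabet of the auxiliary variables `U₁` and `U₂`: a key, the channel output `Bⁿ`, and the
side information `Wⁿ` with one position masked. -/
abbrev AuxAlphabet (𝓦 𝓑 : Type*) (M n : ℕ) : Type _ := Fin M × (Fin n → 𝓑) × (Fin n → 𝓦)

variable {s₀ : 𝓧₁ × 𝓧₂ × 𝓦} {m₁ m₂ : ℕ} (e₁ : AuxAlphabet 𝓦 𝓑 M₁ n ≃ Fin m₁)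
  (e₂ : AuxAlphabet 𝓦 𝓑 M₂ n ≃ Fin m₂)

variable (s₀) in
/-- The pair of auxiliary variables, as a function of the masked source letters, the keys, the
channel inputs and the channel outputs. -/
def auxPair (v : (Fin n → 𝓧₁ × 𝓧₂ × 𝓦) ×
      (((Fin M₁ × Fin M₂) × (Fin n → 𝓐₁ × 𝓐₂)) × (Fin n → 𝓑 × 𝓩))) : Fin m₁ × Fin m₂ :=
  (e₁ (v.2.1.1.1, fun j => (v.2.2 j).1, fun j => (v.1 j).2.2),
    e₂ (v.2.1.1.2, fun j => (v.2.2 j).1, fun j => (v.1 j).2.2))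

variable (s₀) in
/-- The auxiliary variable `U₁` at position `i`. -/
def auxU₁ (i : Fin n) (ω : Space 𝓧₁ 𝓧₂ 𝓦 𝓨 𝓐₁ 𝓐₂ 𝓑 𝓩 M₁ M₂ n) : Fin m₁ :=
  e₁ ((spK ω).1, spB ω, fun j => (Function.update (spS ω) i s₀ j).2.2)

variable (s₀) in
/-- The auxiliary variable `U₂` at position `i`. -/
def auxU₂ (i : Fin n) (ω : Space 𝓧₁ 𝓧₂ 𝓦 𝓨 𝓐₁ 𝓐₂ 𝓑 𝓩 M₁ M₂ n) : Fin m₂ :=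
  e₂ ((spK ω).2, spB ω, fun j => (Function.update (spS ω) i s₀ j).2.2)

variable (s₀) in
/-- The letters of the code that describe sources and simulated output, at position `t`. -/
def letterQ (t : Fin n) : Space 𝓧₁ 𝓧₂ 𝓦 𝓨 𝓐₁ 𝓐₂ 𝓑 𝓩 M₁ M₂ n →
    ((𝓧₁ × 𝓧₂ × 𝓦) × (Fin m₁ × Fin m₂)) × 𝓨 :=
  pair (pair (fun ω => spS ω t) (pair (auxU₁ s₀ e₁ t) (auxU₂ s₀ e₂ t))) fun ω => spY ω t

/-- The letters of the code that describe the channel, at position `t`. -/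
def letterC (t : Fin n) : Space 𝓧₁ 𝓧₂ 𝓦 𝓨 𝓐₁ 𝓐₂ 𝓑 𝓩 M₁ M₂ n → (𝓐₁ × 𝓐₂) × (𝓑 × 𝓩) :=
  pair (fun ω => spA ω t) fun ω => spO ω t

omit [Fintype 𝓧₁] [Fintype 𝓧₂] [Fintype 𝓦] in
lemma mask_congr {i : Fin n} {s s' : Fin n → 𝓧₁ × 𝓧₂ × 𝓦}
    (h : (fun j => (s j).2.2) = fun j => (s' j).2.2) :
    (fun j => (Function.update s i s₀ j).2.2) = fun j => (Function.update s' i s₀ j).2.2 := by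
  funext j
  by_cases hj : j = i
  · subst hj; simp
  · simpa [Function.update_of_ne hj] using congrFun h j

omit [Fintype 𝓧₁] [Fintype 𝓧₂] [Fintype 𝓦] [Fintype 𝓨] [Fintype 𝓐₁] [Fintype 𝓐₂] [Fintype 𝓑]
  [Fintype 𝓩] in
lemma auxU₁_factorsThrough (i : Fin n) :
    (auxU₁ s₀ e₁ i : Space 𝓧₁ 𝓧₂ 𝓦 𝓨 𝓐₁ 𝓐₂ 𝓑 𝓩 M₁ M₂ n → _).FactorsThrough
      (pair (fun ω => (spK ω).1) (pair spB spW)) := by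
  intro ω ω' h
  simp only [pair, Prod.mk.injEq] at h
  unfold auxU₁
  rw [h.1, h.2.1, mask_congr h.2.2]

omit [Fintype 𝓧₁] [Fintype 𝓧₂] [Fintype 𝓦] [Fintype 𝓨] [Fintype 𝓐₁] [Fintype 𝓐₂] [Fintype 𝓑]
  [Fintype 𝓩] in
lemma auxU₂_factorsThrough (i : Fin n) :
    (auxU₂ s₀ e₂ i : Space 𝓧₁ 𝓧₂ 𝓦 𝓨 𝓐₁ 𝓐₂ 𝓑 𝓩 M₁ M₂ n → _).FactorsThrough
      (pair (fun ω => (spK ω).2) (pair spB spW)) := by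
  intro ω ω' h
  simp only [pair, Prod.mk.injEq] at h
  unfold auxU₂
  rw [h.1, h.2.1, mask_congr h.2.2]

variable (s₀) in
/-- The conditional law of `(U₁, U₂)` at position `i` given the source letters `(x₁, x₂)` at this
position. -/
def Code.auxKernel (c : Code 𝓧₁ 𝓧₂ 𝓦 𝓨 𝓐₁ 𝓐₂ 𝓑 M₁ M₂ n) (q : 𝓧₁ × 𝓧₂ × 𝓦 × 𝓨 → ℝ)
    (ch : 𝓐₁ × 𝓐₂ → 𝓑 × 𝓩 → ℝ) (x₁ : 𝓧₁) (x₂ : 𝓧₂) (i : Fin n) : Fin m₁ × Fin m₂ → ℝ :=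
  law (ext (maskLaw q s₀ i) fun s => c.noiseKernel ch (Function.update s i (x₁, x₂, s₀.2.2)))
    (auxPair e₁ e₂)

/-- The conditional law of `Y` at position `i` given `(U₁, U₂)` and the side information `w` at this
position. -/
def Code.outKernel (c : Code 𝓧₁ 𝓧₂ 𝓦 𝓨 𝓐₁ 𝓐₂ 𝓑 M₁ M₂ n) (u₁ : Fin m₁) (u₂ : Fin m₂) (w : 𝓦)
    (i : Fin n) : 𝓨 → ℝ :=
  law (c.dec (e₁.symm u₁).1 (e₂.symm u₂).1 (Function.update (e₁.symm u₁).2.2 i w)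
    (e₁.symm u₁).2.1) fun y => y i

omit [Fintype 𝓧₁] [Fintype 𝓧₂] [Fintype 𝓦] in
lemma Code.noiseKernel_mem (c : Code 𝓧₁ 𝓧₂ 𝓦 𝓨 𝓐₁ 𝓐₂ 𝓑 M₁ M₂ n) {ch : 𝓐₁ × 𝓐₂ → 𝓑 × 𝓩 → ℝ}
    (hch : ∀ a, ch a ∈ stdSimplex ℝ (𝓑 × 𝓩)) (hM₁ : 0 < M₁) (hM₂ : 0 < M₂)
    (s : Fin n → 𝓧₁ × 𝓧₂ × 𝓦) : c.noiseKernel ch s ∈ stdSimplex ℝ _ :=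
  ext_mem (ext_mem (unif_mem hM₁ hM₂) fun _ => c.encKernel_mem _)
    fun _ => prod_mem_stdSimplex fun _ => hch _

lemma maskLaw_mem {q : 𝓧₁ × 𝓧₂ × 𝓦 × 𝓨 → ℝ} (hq : q ∈ stdSimplex ℝ (𝓧₁ × 𝓧₂ × 𝓦 × 𝓨))
    (i : Fin n) : maskLaw q s₀ i ∈ stdSimplex ℝ (Fin n → 𝓧₁ × 𝓧₂ × 𝓦) := by
  classical
  refine prod_mem_stdSimplex fun j => ?_
  split_ifs
  · convert single_mem_stdSimplex ℝ s₀
  · exact srcLaw_mem hq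

section Facts

variable (c : Code 𝓧₁ 𝓧₂ 𝓦 𝓨 𝓐₁ 𝓐₂ 𝓑 M₁ M₂ n) {q : 𝓧₁ × 𝓧₂ × 𝓦 × 𝓨 → ℝ}
  (hq : q ∈ stdSimplex ℝ (𝓧₁ × 𝓧₂ × 𝓦 × 𝓨)) {ch : 𝓐₁ × 𝓐₂ → 𝓑 × 𝓩 → ℝ}
  (hch : ∀ a, ch a ∈ stdSimplex ℝ (𝓑 × 𝓩)) (hM₁ : 0 < M₁) (hM₂ : 0 < M₂)

include hq hch hM₁ hM₂

lemma Code.law_letter (i : Fin n) : law (c.pmf q ch) (fun ω => spS ω i) = srcLaw q := by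
  rw [← law_law (c.pmf q ch) spS fun s => s i, c.law_spS hch hM₁ hM₂]
  exact law_prod_eval (fun _ => (srcLaw_mem hq).2) i

/-- The source letter at position `i` is independent of the masked source sequence. -/
lemma Code.hasCond_mask (i : Fin n) :
    HasCond (c.pmf q ch) (fun ω => spS ω i) (fun ω => Function.update (spS ω) i s₀)
      fun _ => maskLaw q s₀ i := by
  classical
  intro a s'
  rw [c.law_letter hq hch hM₁ hM₂]
  have h1 : law (c.pmf q ch) (pair (fun ω => spS ω i) fun ω => Function.update (spS ω) i s₀) =
      law (law (c.pmf q ch) spS) fun s => (s i, Function.update s i s₀) := by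
    rw [law_law]; rfl
  rw [h1, c.law_spS hch hM₁ hM₂]
  unfold law maskLaw
  rw [Finset.sum_eq_single (Function.update s' i a)]
  · simp only [Function.update_self, Function.update_idem, Prod.mk.injEq, true_and]
    rw [← Finset.mul_prod_erase _ _ (Finset.mem_univ i),
      ← Finset.mul_prod_erase (s := Finset.univ) (a := i) _ (Finset.mem_univ i)]
    have h2 : ∏ j ∈ Finset.univ.erase i, srcLaw q (Function.update s' i a j) =
        ∏ j ∈ Finset.univ.erase i, (if j = i then Pi.single s₀ 1 else srcLaw q) (s' j) :=
      Finset.prod_congr rfl fun j hj => by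
        rw [Function.update_of_ne (Finset.ne_of_mem_erase hj), if_neg (Finset.ne_of_mem_erase hj)]
    rw [h2, Function.update_self, if_pos rfl]
    by_cases h3 : s' i = s₀
    · rw [if_pos (by rw [← h3, Function.update_eq_self]), h3, Pi.single_eq_same, one_mul]
    · rw [if_neg fun h => h3 (by rw [← h, Function.update_self]), Pi.single_eq_of_ne h3]
      simp
  · intro s _ hs
    rw [if_neg]
    rintro h
    simp only [Prod.mk.injEq] at h
    apply hs
    rw [← h.1, ← h.2, Function.update_idem, Function.update_eq_self]
  · simp

lemma Code.hasCond_aux (i : Fin n) :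
    HasCond (c.pmf q ch) (fun ω => spS ω i) (pair (auxU₁ s₀ e₁ i) (auxU₂ s₀ e₂ i))
      fun a => c.auxKernel s₀ e₁ e₂ q ch a.1 a.2.1 i := by
  have h1 := (c.hasCond_spK (q := q) hch hM₁ hM₂).comp
    (κ' := fun s k => c.encKernel (s, k)) (c.hasCond_spA hch)
  have h2 : HasCond (c.pmf q ch) (pair spS (pair spK spA)) spO fun v o => ∏ i, ch (v.2.2 i) (o i) :=
    (c.hasCond_spO hch).map_left fun v : ((Fin n → 𝓧₁ × 𝓧₂ × 𝓦) × (Fin M₁ × Fin M₂)) ×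
      (Fin n → 𝓐₁ × 𝓐₂) => (v.1.1, (v.1.2, v.2))
  have h3 := h1.comp (κ' := fun _ (v : (Fin M₁ × Fin M₂) × (Fin n → 𝓐₁ × 𝓐₂))
    (o : Fin n → 𝓑 × 𝓩) => ∏ i, ch (v.2 i) (o i)) h2
  have h4 : HasCond (c.pmf q ch) (pair (fun ω => spS ω i) fun ω => Function.update (spS ω) i s₀)
      (pair (pair spK spA) spO) fun v => c.noiseKernel ch (Function.update v.2 i v.1) := by
    refine HasCond.map_left (fun s : Fin n → 𝓧₁ × 𝓧₂ × 𝓦 => (s i, Function.update s i s₀)) ?_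
    simp only [Function.update_idem, Function.update_eq_self]
    exact h3
  have h5 := ((c.hasCond_mask (s₀ := s₀) hq hch hM₁ hM₂ i).comp
    (κ' := fun a s => c.noiseKernel ch (Function.update s i a)) h4).map_right (auxPair e₁ e₂)
  -- the encoders do not see the side information, so its value at position `i` is immaterial
  have h6 : ∀ (a : 𝓧₁ × 𝓧₂ × 𝓦) (s : Fin n → 𝓧₁ × 𝓧₂ × 𝓦),
      c.noiseKernel ch (Function.update s i a) =
        c.noiseKernel ch (Function.update s i (a.1, a.2.1, s₀.2.2)) := by
    intro a s
    have e1 : (fun j => (Function.update s i a j).1) =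
        fun j => (Function.update s i (a.1, a.2.1, s₀.2.2) j).1 := by
      funext j
      by_cases hj : j = i
      · subst hj; simp
      · simp [Function.update_of_ne hj]
    have e2 : (fun j => (Function.update s i a j).2.1) =
        fun j => (Function.update s i (a.1, a.2.1, s₀.2.2) j).2.1 := by
      funext j
      by_cases hj : j = i
      · subst hj; simp
      · simp [Function.update_of_ne hj]
    unfold Code.noiseKernel Code.encKernel
    simp only [e1, e2]
  have h7 : ∀ a : 𝓧₁ × 𝓧₂ × 𝓦, c.auxKernel s₀ e₁ e₂ q ch a.1 a.2.1 i =
      law (ext (maskLaw q s₀ i) fun s => c.noiseKernel ch (Function.update s i a))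
        (auxPair e₁ e₂) := by
    intro a
    simp only [Code.auxKernel, h6 a]
  simp only [h7]
  exact h5

omit hq hch hM₁ hM₂ in
lemma Code.hasCond_out (i : Fin n) :
    HasCond (c.pmf q ch) (pair (fun ω => spS ω i) (pair (auxU₁ s₀ e₁ i) (auxU₂ s₀ e₂ i)))
      (fun ω => spY ω i) fun v => c.outKernel e₁ e₂ v.2.1 v.2.2 v.1.2.2 i := by
  have h1 := (c.hasCond_spY (q := q) (ch := ch)).map_right fun y => y i
  refine HasCond.map_left (fun v : (((Fin n → 𝓧₁ × 𝓧₂ × 𝓦) × (Fin M₁ × Fin M₂)) ×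
    (Fin n → 𝓐₁ × 𝓐₂)) × (Fin n → 𝓑 × 𝓩) => (v.1.1.1 i,
      (e₁ (v.1.1.2.1, fun j => (v.2 j).1, fun j => (Function.update v.1.1.1 i s₀ j).2.2),
        e₂ (v.1.1.2.2, fun j => (v.2 j).1, fun j => (Function.update v.1.1.1 i s₀ j).2.2))))
    (V := pair (pair (pair spS spK) spA) spO) ?_
  have h2 : ∀ s : Fin n → 𝓧₁ × 𝓧₂ × 𝓦, Function.update
      (fun j => (Function.update s i s₀ j).2.2) i (s i).2.2 = fun j => (s j).2.2 := by
    intro s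
    funext j
    by_cases hj : j = i
    · subst hj; simp
    · simp [Function.update_of_ne hj]
  simp only [Code.outKernel, Equiv.symm_apply_apply, h2]
  exact h1

omit hq hM₁ hM₂ in
lemma Code.hasCond_channel (i : Fin n) :
    HasCond (c.pmf q ch) (fun ω => spA ω i) (fun ω => spO ω i) ch := by
  have h := (c.hasCond_spO (q := q) hch).map_right fun o => o i
  simp only [law_prod_eval fun _ => (hch _).2] at h
  exact HasCond.map_left (fun v : ((Fin n → 𝓧₁ × 𝓧₂ × 𝓦) × (Fin M₁ × Fin M₂)) ×
    (Fin n → 𝓐₁ × 𝓐₂) => v.2 i) h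

variable (s₀)

/-- The factors of the single-letter p.m.f. given by a code; the time-sharing variable is a uniform
position. -/
def Code.auxiliary (hn : 0 < n) :
    Auxiliary 𝓧₁ 𝓧₂ 𝓦 𝓨 𝓐₁ 𝓐₂ (Fin n) (Fin m₁) (Fin m₂) where
  pT _ := 1 / n
  pU x₁ x₂ t := c.auxKernel s₀ e₁ e₂ q ch x₁ x₂ t
  pA t := law (c.pmf q ch) fun ω => spA ω t
  pY u₁ u₂ w t := c.outKernel e₁ e₂ u₁ u₂ w t
  pT_mem := by
    have : (n : ℝ) ≠ 0 := by exact_mod_cast hn.ne'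
    refine ⟨fun _ => by positivity, ?_⟩
    simp [this]
  pU_mem _ _ _ := law_mem (ext_mem (maskLaw_mem hq _) fun _ => c.noiseKernel_mem hch hM₁ hM₂ _) _
  pA_mem _ := law_mem (c.pmf_mem hq hch hM₁ hM₂) _
  pY_mem _ _ _ _ := law_mem (c.dec_mem _ _ _ _) _

lemma Code.auxiliary_givenT (hn : 0 < n) (t : Fin n) (x₁ : 𝓧₁) (x₂ : 𝓧₂) (w : 𝓦) (u₁ : Fin m₁)
    (u₂ : Fin m₂) (a₁ : 𝓐₁) (a₂ : 𝓐₂) (b : 𝓑) (z : 𝓩) (y : 𝓨) :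
    (c.auxiliary s₀ e₁ e₂ hq hch hM₁ hM₂ hn).givenT q ch t x₁ x₂ w u₁ u₂ a₁ a₂ b z y =
      law (c.pmf q ch) (letterQ s₀ e₁ e₂ t) (((x₁, x₂, w), (u₁, u₂)), y) *
        law (c.pmf q ch) (letterC t) ((a₁, a₂), (b, z)) := by
  unfold letterQ letterC
  rw [c.hasCond_out, c.hasCond_aux e₁ e₂ hq hch hM₁ hM₂, c.law_letter hq hch hM₁ hM₂,
    c.hasCond_channel hch]
  simp only [Auxiliary.givenT, Code.auxiliary, srcLaw]
  ring

end Facts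

end AuxiliaryOfCode

/-! ### The single-letter p.m.f. of a code -/

section SampleSpace

variable {𝓧₁ 𝓧₂ 𝓦 𝓣 𝓤₁ 𝓤₂ 𝓐₁ 𝓐₂ 𝓑 𝓩 𝓨 : Type*}

/-- The variables that describe sources and simulated output, auxiliary variables included. -/
def rvQ : Sample 𝓧₁ 𝓧₂ 𝓦 𝓣 𝓤₁ 𝓤₂ 𝓐₁ 𝓐₂ 𝓑 𝓩 𝓨 → ((𝓧₁ × 𝓧₂ × 𝓦) × (𝓤₁ × 𝓤₂)) × 𝓨 :=
  fun ω => (((rvX₁ ω, rvX₂ ω, rvW ω), (rvU₁ ω, rvU₂ ω)), rvY ω)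

/-- The variables that describe the channel. -/
def rvC : Sample 𝓧₁ 𝓧₂ 𝓦 𝓣 𝓤₁ 𝓤₂ 𝓐₁ 𝓐₂ 𝓑 𝓩 𝓨 → (𝓐₁ × 𝓐₂) × (𝓑 × 𝓩) :=
  fun ω => ((rvA₁ ω, rvA₂ ω), (rvB ω, rvZ ω))

/-- The sample space of the single-letter p.m.f. as a product, with the variables that describe
sources and simulated output in front. -/
def sampleEquivQ : Sample 𝓧₁ 𝓧₂ 𝓦 𝓣 𝓤₁ 𝓤₂ 𝓐₁ 𝓐₂ 𝓑 𝓩 𝓨 ≃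
    ((((𝓧₁ × 𝓧₂ × 𝓦) × (𝓤₁ × 𝓤₂)) × 𝓨) × 𝓣) × ((𝓐₁ × 𝓐₂) × (𝓑 × 𝓩)) where
  toFun ω := ((rvQ ω, rvT ω), rvC ω)
  invFun v := (v.1.1.1.1.1, v.1.1.1.1.2.1, v.1.1.1.1.2.2, v.1.2, v.1.1.1.2.1, v.1.1.1.2.2,
    v.2.1.1, v.2.1.2, v.2.2.1, v.2.2.2, v.1.1.2)
  left_inv _ := rfl
  right_inv _ := rfl

/-- The sample space of the single-letter p.m.f. as a product, with the variables that describe the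
channel in front. -/
def sampleEquivC : Sample 𝓧₁ 𝓧₂ 𝓦 𝓣 𝓤₁ 𝓤₂ 𝓐₁ 𝓐₂ 𝓑 𝓩 𝓨 ≃
    (((𝓐₁ × 𝓐₂) × (𝓑 × 𝓩)) × 𝓣) × (((𝓧₁ × 𝓧₂ × 𝓦) × (𝓤₁ × 𝓤₂)) × 𝓨) where
  toFun ω := ((rvC ω, rvT ω), rvQ ω)
  invFun v := sampleEquivQ.symm ((v.2, v.1.2), v.1.1)
  left_inv _ := rfl
  right_inv _ := rfl

end SampleSpace

section SingleLetterPmf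

variable {𝓧₁ 𝓧₂ 𝓦 𝓨 𝓐₁ 𝓐₂ 𝓑 𝓩 : Type*} [Fintype 𝓧₁] [Fintype 𝓧₂] [Fintype 𝓦] [Fintype 𝓨]
  [Fintype 𝓐₁] [Fintype 𝓐₂] [Fintype 𝓑] [Fintype 𝓩] {M₁ M₂ n : ℕ}
  (s₀ : 𝓧₁ × 𝓧₂ × 𝓦) {m₁ m₂ : ℕ} (e₁ : AuxAlphabet 𝓦 𝓑 M₁ n ≃ Fin m₁)
  (e₂ : AuxAlphabet 𝓦 𝓑 M₂ n ≃ Fin m₂) (c : Code 𝓧₁ 𝓧₂ 𝓦 𝓨 𝓐₁ 𝓐₂ 𝓑 M₁ M₂ n)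
  {q : 𝓧₁ × 𝓧₂ × 𝓦 × 𝓨 → ℝ} (hq : q ∈ stdSimplex ℝ (𝓧₁ × 𝓧₂ × 𝓦 × 𝓨))
  {ch : 𝓐₁ × 𝓐₂ → 𝓑 × 𝓩 → ℝ} (hch : ∀ a, ch a ∈ stdSimplex ℝ (𝓑 × 𝓩)) (hM₁ : 0 < M₁)
  (hM₂ : 0 < M₂) (hn : 0 < n)

/-- Given `T = t`, the variables of sources and simulated output and those of the channel have the
laws of the code at position `t`, and are independent. -/
lemma Code.auxiliary_joint (v : ((((𝓧₁ × 𝓧₂ × 𝓦) × (Fin m₁ × Fin m₂)) × 𝓨) × Fin n) ×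
      ((𝓐₁ × 𝓐₂) × (𝓑 × 𝓩))) :
    (c.auxiliary s₀ e₁ e₂ hq hch hM₁ hM₂ hn).joint q ch (sampleEquivQ.symm v) =
      1 / n * (law (c.pmf q ch) (letterQ s₀ e₁ e₂ v.1.2) v.1.1 *
        law (c.pmf q ch) (letterC v.1.2) v.2) := by
  rw [← c.auxiliary_givenT s₀ e₁ e₂ hq hch hM₁ hM₂ hn]
  rfl

lemma Code.auxiliary_joint_nonneg (ω : Sample 𝓧₁ 𝓧₂ 𝓦 (Fin n) (Fin m₁) (Fin m₂) 𝓐₁ 𝓐₂ 𝓑 𝓩 𝓨) :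
    0 ≤ (c.auxiliary s₀ e₁ e₂ hq hch hM₁ hM₂ hn).joint q ch ω := by
  rw [← sampleEquivQ.symm_apply_apply ω, Code.auxiliary_joint]
  have hp := (c.pmf_mem hq hch hM₁ hM₂).1
  exact mul_nonneg (by positivity) (mul_nonneg (law_nonneg hp _ _) (law_nonneg hp _ _))

lemma Code.isMixture_rvQ :
    IsMixture ((c.auxiliary s₀ e₁ e₂ hq hch hM₁ hM₂ hn).joint q ch) rvQ rvT (c.pmf q ch)
      (letterQ s₀ e₁ e₂) := by
  intro d t
  refine (law_equiv_fst _ sampleEquivQ (d, t)).trans ?_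
  simp only [Code.auxiliary_joint, ← Finset.mul_sum, sum_law, (c.pmf_mem hq hch hM₁ hM₂).2, mul_one]

lemma Code.isMixture_rvC :
    IsMixture ((c.auxiliary s₀ e₁ e₂ hq hch hM₁ hM₂ hn).joint q ch) rvC rvT (c.pmf q ch)
      letterC := by
  intro d t
  refine (law_equiv_fst _ sampleEquivC (d, t)).trans ?_
  change ∑ v, (c.auxiliary s₀ e₁ e₂ hq hch hM₁ hM₂ hn).joint q ch
    (sampleEquivQ.symm ((v, t), d)) = _
  simp only [Code.auxiliary_joint, ← Finset.mul_sum, ← Finset.sum_mul, sum_law,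
    (c.pmf_mem hq hch hM₁ hM₂).2, one_mul]

lemma Code.auxiliary_targetGivenT (t : Fin n) :
    (c.auxiliary s₀ e₁ e₂ hq hch hM₁ hM₂ hn).targetGivenT q ch t =
      law (c.pmf q ch) fun ω => spQ ω t := by
  have hp := c.pmf_mem hq hch hM₁ hM₂
  funext ⟨x₁, x₂, w, y⟩
  have h1 : law (c.pmf q ch) (fun ω => spQ ω t) =
      law (law (c.pmf q ch) (letterQ s₀ e₁ e₂ t)) fun d => (d.1.1.1, d.1.1.2.1, d.1.1.2.2, d.2) := by
    rw [law_law]; rfl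
  let e : (((𝓧₁ × 𝓧₂ × 𝓦) × (Fin m₁ × Fin m₂)) × 𝓨) ≃ (𝓧₁ × 𝓧₂ × 𝓦 × 𝓨) × (Fin m₁ × Fin m₂) :=
    { toFun := fun d => ((d.1.1.1, d.1.1.2.1, d.1.1.2.2, d.2), d.1.2)
      invFun := fun v => (((v.1.1, v.1.2.1, v.1.2.2.1), v.2), v.1.2.2.2)
      left_inv := fun _ => rfl
      right_inv := fun _ => rfl }
  have h2 := law_equiv_fst (law (c.pmf q ch) (letterQ s₀ e₁ e₂ t)) e (x₁, x₂, w, y)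
  rw [h1]
  refine Eq.trans ?_ h2.symm
  have h3 : ∑ a₁, ∑ a₂, ∑ b, ∑ z, law (c.pmf q ch) (letterC t) ((a₁, a₂), (b, z)) = 1 := by
    rw [← hp.2, ← sum_law (c.pmf q ch) (letterC t)]
    simp only [Fintype.sum_prod_type]
  rw [Fintype.sum_prod_type]
  simp only [Auxiliary.targetGivenT, c.auxiliary_givenT s₀ e₁ e₂ hq hch hM₁ hM₂ hn,
    ← Finset.mul_sum, h3, mul_one]
  rfl

include s₀ hq hch hM₁ hM₂ hn in
/-- The single-letter bounds satisfied by a code, with the key rates replaced by the key entropies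
per letter. -/
lemma Code.exists_auxiliary {δ : ℝ} (hδ : 0 < δ) (hδ1 : δ ≤ 1)
    (h : tv (c.induced q ch) (c.ideal q ch) ≤ δ) {ε r : ℝ} (hδε : δ ≤ ε)
    (hr : modulus (Fintype.card 𝓩 * Fintype.card (𝓧₁ × 𝓧₂ × 𝓦 × 𝓨)) δ +
      modulus (Fintype.card (𝓧₁ × 𝓧₂ × 𝓦 × 𝓨)) δ ≤ r) :
    ∃ (m₁ m₂ : ℕ) (P : Auxiliary 𝓧₁ 𝓧₂ 𝓦 𝓨 𝓐₁ 𝓐₂ (Fin n) (Fin m₁) (Fin m₂)),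
      (∀ t, tv (P.targetGivenT q ch t) q ≤ ε) ∧
      condMI (P.joint q ch) rvU₁ rvX₁ (pair rvU₂ (pair rvX₂ (pair rvW rvT))) ≤
        condMI (P.joint q ch) rvA₁ rvB (pair rvA₂ rvT) ∧
      condMI (P.joint q ch) rvU₂ rvX₂ (pair rvU₁ (pair rvX₁ (pair rvW rvT))) ≤
        condMI (P.joint q ch) rvA₂ rvB (pair rvA₁ rvT) ∧
      condMI (P.joint q ch) (pair rvU₁ rvU₂) (pair rvX₁ rvX₂) (pair rvW rvT) ≤
        condMI (P.joint q ch) (pair rvA₁ rvA₂) rvB rvT ∧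
      condMI (P.joint q ch) (pair rvU₁ rvU₂) (pair rvX₁ (pair rvX₂ rvY)) (pair rvW rvT)
          - condEntropy (P.joint q ch) rvY (pair rvX₁ (pair rvX₂ (pair rvW rvT)))
          - condMI (P.joint q ch) (pair rvA₁ rvA₂) rvB (pair rvZ rvT) ≤
        ent (c.pmf q ch) spK / n + r ∧
      condMI (P.joint q ch) rvU₁ (pair rvX₁ (pair rvX₂ rvY)) (pair rvW rvT)
          - condEntropy (P.joint q ch) rvY (pair rvX₁ (pair rvX₂ (pair rvW rvT)))
          - condMI (P.joint q ch) (pair rvA₁ rvA₂) rvB (pair rvZ rvT) ≤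
        ent (c.pmf q ch) (fun ω => (spK ω).1) / n + r ∧
      condMI (P.joint q ch) rvU₂ (pair rvX₁ (pair rvX₂ rvY)) (pair rvW rvT)
          - condEntropy (P.joint q ch) rvY (pair rvX₁ (pair rvX₂ (pair rvW rvT)))
          - condMI (P.joint q ch) (pair rvA₁ rvA₂) rvB (pair rvZ rvT) ≤
        ent (c.pmf q ch) (fun ω => (spK ω).2) / n + r := by
  let e₁ := Fintype.equivFin (AuxAlphabet 𝓦 𝓑 M₁ n)
  let e₂ := Fintype.equivFin (AuxAlphabet 𝓦 𝓑 M₂ n)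
  refine ⟨_, _, c.auxiliary s₀ e₁ e₂ hq hch hM₁ hM₂ hn, fun t => ?_, ?_⟩
  · rw [c.auxiliary_targetGivenT]
    exact (c.tv_letter_le hq hch hM₁ hM₂ t).trans (h.trans hδε)
  have hp := c.pmf_mem hq hch hM₁ hM₂
  have hp' := c.auxiliary_joint_nonneg s₀ e₁ e₂ hq hch hM₁ hM₂ hn
  have hQ := c.isMixture_rvQ s₀ e₁ e₂ hq hch hM₁ hM₂ hn
  have hC := c.isMixture_rvC s₀ e₁ e₂ hq hch hM₁ hM₂ hn
  have hn0 : (0 : ℝ) < n := by exact_mod_cast hn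
  have hn1 : (0 : ℝ) ≤ 1 / n := by positivity
  have hU₁ : ∀ i, (auxU₁ s₀ e₁ i : Space 𝓧₁ 𝓧₂ 𝓦 𝓨 𝓐₁ 𝓐₂ 𝓑 𝓩 M₁ M₂ n → _).FactorsThrough
      (pair (fun ω => (spK ω).1) (pair spB spW)) := auxU₁_factorsThrough e₁
  have hU₂ : ∀ i, (auxU₂ s₀ e₂ i : Space 𝓧₁ 𝓧₂ 𝓦 𝓨 𝓐₁ 𝓐₂ 𝓑 𝓩 M₁ M₂ n → _).FactorsThrough
      (pair (fun ω => (spK ω).2) (pair spB spW)) := auxU₂_factorsThrough e₂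
  generalize (c.auxiliary s₀ e₁ e₂ hq hch hM₁ hM₂ hn).joint q ch = p' at *
  have hY : condEntropy p' rvY (pair rvX₁ (pair rvX₂ (pair rvW rvT))) =
      1 / n * ∑ i, condEntropy (c.pmf q ch) (fun ω => spY ω i) fun ω => spS ω i :=
    hQ.condEntropy_eq hp' hp hn (fun d => d.2) (fun d => d.1.1) fun ω ω' => by
      simp only [rvQ, pair, Prod.mk.injEq, and_assoc]
  have hZ : condMI p' (pair rvA₁ rvA₂) rvB (pair rvZ rvT) =
      1 / n * ∑ i, condMI (c.pmf q ch) (fun ω => spA ω i) (fun ω => spB ω i) fun ω => spZ ω i :=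
    hC.condMI_eq hp' hp hn (fun d => d.1) (fun d => d.2.1) (fun d => d.2.2) fun ω ω' => by
      simp only [rvC, pair, Prod.mk.injEq]
  have rate : ∀ {κ 𝓤 : Type} [Fintype κ] [Fintype 𝓤] (j : Fin M₁ × Fin M₂ → κ)
      (U : Fin n → Space 𝓧₁ 𝓧₂ 𝓦 𝓨 𝓐₁ 𝓐₂ 𝓑 𝓩 M₁ M₂ n → 𝓤)
      (_ : ∀ i, (U i).FactorsThrough (pair (fun ω => j (spK ω)) (pair spB spW))) {I : ℝ}
      (_ : I = 1 / n * ∑ i, condMI (c.pmf q ch) (U i)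
        (fun ω => ((spS ω i).1, (spS ω i).2.1, spY ω i)) fun ω => spW ω i),
      I - condEntropy p' rvY (pair rvX₁ (pair rvX₂ (pair rvW rvT))) -
        condMI p' (pair rvA₁ rvA₂) rvB (pair rvZ rvT) ≤
      ent (c.pmf q ch) (fun ω => j (spK ω)) / n + r := by
    intro κ 𝓤 _ _ j U hU I hI
    have h1 := c.sum_sub_le_ent_key hq hch hM₁ hM₂ hn hδ hδ1 h j hU
    have h2 := mul_le_mul_of_nonneg_left h1 hn1
    rw [hI, hY, hZ, ← mul_sub, ← mul_sub, ← Finset.sum_sub_distrib, ← Finset.sum_sub_distrib]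
    refine h2.trans ?_
    rw [mul_add, ← mul_assoc, one_div_mul_cancel hn0.ne', one_mul, one_div_mul_eq_div]
    linarith
  refine ⟨?_, ?_, ?_, ?_, ?_, ?_⟩
  · have e1 : condMI p' rvA₁ rvB (pair rvA₂ rvT) = 1 / n * ∑ i, condMI (c.pmf q ch)
        (fun ω => (spA ω i).1) (fun ω => spB ω i) fun ω => (spA ω i).2 :=
      hC.condMI_eq hp' hp hn (fun d => d.1.1) (fun d => d.2.1) (fun d => d.1.2) fun ω ω' => by
        simp only [rvC, pair, Prod.mk.injEq]
    have e2 : condMI p' rvU₁ rvX₁ (pair rvU₂ (pair rvX₂ (pair rvW rvT))) =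
        1 / n * ∑ i, condMI (c.pmf q ch) (auxU₁ s₀ e₁ i) (fun ω => (spS ω i).1)
          (pair (auxU₂ s₀ e₂ i) fun ω => (spS ω i).2) :=
      hQ.condMI_eq hp' hp hn (fun d => d.1.2.1) (fun d => d.1.1.1) (fun d => (d.1.2.2, d.1.1.2))
        fun ω ω' => by simp only [rvQ, pair, Prod.mk.injEq, and_assoc]
    rw [e1, e2]
    exact mul_le_mul_of_nonneg_left (c.sum_condMI_le₁ hq hch hM₁ hM₂ hU₁ hU₂) hn1
  · have e1 : condMI p' rvA₂ rvB (pair rvA₁ rvT) = 1 / n * ∑ i, condMI (c.pmf q ch)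
        (fun ω => (spA ω i).2) (fun ω => spB ω i) fun ω => (spA ω i).1 :=
      hC.condMI_eq hp' hp hn (fun d => d.1.2) (fun d => d.2.1) (fun d => d.1.1) fun ω ω' => by
        simp only [rvC, pair, Prod.mk.injEq]
    have e2 : condMI p' rvU₂ rvX₂ (pair rvU₁ (pair rvX₁ (pair rvW rvT))) =
        1 / n * ∑ i, condMI (c.pmf q ch) (auxU₂ s₀ e₂ i) (fun ω => (spS ω i).2.1)
          (pair (auxU₁ s₀ e₁ i) fun ω => ((spS ω i).1, (spS ω i).2.2)) :=
      hQ.condMI_eq hp' hp hn (fun d => d.1.2.2) (fun d => d.1.1.2.1)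
        (fun d => (d.1.2.1, (d.1.1.1, d.1.1.2.2)))
        fun ω ω' => by simp only [rvQ, pair, Prod.mk.injEq, and_assoc]
    rw [e1, e2]
    exact mul_le_mul_of_nonneg_left (c.sum_condMI_le₂ hq hch hM₁ hM₂ hU₁ hU₂) hn1
  · have e1 : condMI p' (pair rvA₁ rvA₂) rvB rvT = 1 / n * ∑ i, condMI (c.pmf q ch)
        (fun ω => spA ω i) (fun ω => spB ω i) fun _ => () :=
      hC.condMI_eq hp' hp hn (fun d => d.1) (fun d => d.2.1) (fun _ => ()) fun ω ω' => by simp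
    have e2 : condMI p' (pair rvU₁ rvU₂) (pair rvX₁ rvX₂) (pair rvW rvT) =
        1 / n * ∑ i, condMI (c.pmf q ch) (pair (auxU₁ s₀ e₁ i) (auxU₂ s₀ e₂ i))
          (fun ω => ((spS ω i).1, (spS ω i).2.1)) (fun ω => spW ω i) :=
      hQ.condMI_eq hp' hp hn (fun d => d.1.2) (fun d => (d.1.1.1, d.1.1.2.1)) (fun d => d.1.1.2.2)
        fun ω ω' => by simp only [rvQ, pair, Prod.mk.injEq]
    rw [e1, e2]
    exact mul_le_mul_of_nonneg_left (c.sum_condMI_le₁₂ hq hch hM₁ hM₂ hU₁ hU₂) hn1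
  · refine rate (fun k => k) (fun i => pair (auxU₁ s₀ e₁ i) (auxU₂ s₀ e₂ i))
      (fun i ω ω' h => ?_) ?_
    · simp only [pair, Prod.mk.injEq] at h ⊢
      exact ⟨hU₁ i (by simp only [pair, h]), hU₂ i (by simp only [pair, h])⟩
    · exact hQ.condMI_eq hp' hp hn (fun d => d.1.2) (fun d => (d.1.1.1, d.1.1.2.1, d.2))
        (fun d => d.1.1.2.2) fun ω ω' => by simp only [rvQ, pair, Prod.mk.injEq]
  · exact rate Prod.fst (auxU₁ s₀ e₁) hU₁
      (hQ.condMI_eq hp' hp hn (fun d => d.1.2.1) (fun d => (d.1.1.1, d.1.1.2.1, d.2))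
        (fun d => d.1.1.2.2) fun ω ω' => by simp only [rvQ, pair, Prod.mk.injEq])
  · exact rate Prod.snd (auxU₂ s₀ e₂) hU₂
      (hQ.condMI_eq hp' hp hn (fun d => d.1.2.2) (fun d => (d.1.1.1, d.1.1.2.1, d.2))
        (fun d => d.1.1.2.2) fun ω ω' => by simp only [rvQ, pair, Prod.mk.injEq])

end SingleLetterPmf

/-! ### Rates and slack -/

section Rates

lemma numKeys_pos {R : ℝ} (hR : 0 ≤ R) (n : ℕ) : 0 < numKeys n R :=
  Nat.floor_pos.2 (Real.one_le_rpow one_le_two (by positivity))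

lemma logb_numKeys_le {R : ℝ} (hR : 0 ≤ R) (n : ℕ) : Real.logb 2 (numKeys n R) ≤ n * R := by
  have h : (0 : ℝ) < numKeys n R := by exact_mod_cast numKeys_pos hR n
  rw [Real.logb_le_iff_le_rpow one_lt_two h]
  exact Nat.floor_le (by positivity)

lemma tendsto_modulus (N : ℝ) : Tendsto (modulus N) (𝓝[>] 0) (𝓝 0) := by
  have h : modulus N = fun δ =>
      δ * Real.logb 2 N + (Real.negMulLog δ / Real.log 2 + 2 * δ / Real.log 2) := by
    funext δ
    simp only [modulus, Real.logb, Real.log_inv, Real.negMulLog]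
    ring
  have hc : Continuous (modulus N) := by
    rw [h]
    fun_prop
  have := (hc.tendsto 0).mono_left (nhdsWithin_le_nhds (s := Set.Ioi 0))
  simpa [modulus] using this

lemma pmfEntropy_nonneg {α : Type*} [Fintype α] {p : α → ℝ} (hp : p ∈ stdSimplex ℝ α) :
    0 ≤ pmfEntropy p := by
  rw [pmfEntropy_eq_ent_id, ← ent_const hp ()]
  exact ent_mono hp.1 fun _ _ _ => rfl

/-- As `ε < 1`, the logarithm in the slack is positive, even for trivial alphabets. -/
lemma slack_pos {𝓧₁ 𝓧₂ 𝓦 𝓨 𝓩 : Type*} [Fintype 𝓧₁] [Fintype 𝓧₂] [Fintype 𝓦] [Fintype 𝓨]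
    [Fintype 𝓩] [Nonempty 𝓩] {q : 𝓧₁ × 𝓧₂ × 𝓦 × 𝓨 → ℝ}
    (hq : q ∈ stdSimplex ℝ (𝓧₁ × 𝓧₂ × 𝓦 × 𝓨)) {ε : ℝ} (hε : 0 < ε) (hε1 : ε < 1)
    (hne : Nonempty (𝓧₁ × 𝓧₂ × 𝓦 × 𝓨)) : 0 < slack 𝓩 q ε := by
  have h1 : (1 : ℝ) ≤ (Fintype.card 𝓧₁ : ℝ) * Fintype.card 𝓧₂ * Fintype.card 𝓦 *
      Fintype.card 𝓨 * Fintype.card 𝓩 := by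
    have h2 : 0 < Fintype.card (𝓧₁ × 𝓧₂ × 𝓦 × 𝓨) * Fintype.card 𝓩 :=
      Nat.mul_pos Fintype.card_pos Fintype.card_pos
    simp only [Fintype.card_prod, ← mul_assoc] at h2
    exact_mod_cast h2
  unfold slack
  have h3 := pmfEntropy_nonneg hq
  have h4 := Real.logb_pos one_lt_two ((one_lt_div hε).2 (hε1.trans_le h1))
  have h5 := Real.sqrt_pos.2 hε
  positivity

end Rates

end

end Coordination

open Coordination in
theorem theorem2 {𝓧₁ 𝓧₂ 𝓦 𝓨 𝓐₁ 𝓐₂ 𝓑 𝓩 : Type*} [Fintype 𝓧₁] [Fintype 𝓧₂] [Fintype 𝓦]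
    [Fintype 𝓨] [Fintype 𝓐₁] [Fintype 𝓐₂] [Fintype 𝓑] [Fintype 𝓩]
    (q : 𝓧₁ × 𝓧₂ × 𝓦 × 𝓨 → ℝ) (hq : q ∈ stdSimplex ℝ (𝓧₁ × 𝓧₂ × 𝓦 × 𝓨))
    (ch : 𝓐₁ × 𝓐₂ → 𝓑 × 𝓩 → ℝ) (hch : ∀ a, ch a ∈ stdSimplex ℝ (𝓑 × 𝓩))
    (R₀₁ R₀₂ : ℝ) (hR : (R₀₁, R₀₂) ∈ rateRegion q ch)
    (ε : ℝ) (hε : ε ∈ Set.Ioc (0 : ℝ) (1 / 4)) :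
    ∃ (mT m₁ m₂ : ℕ) (P : Auxiliary 𝓧₁ 𝓧₂ 𝓦 𝓨 𝓐₁ 𝓐₂ (Fin mT) (Fin m₁) (Fin m₂)),
      (∀ t, tv (P.targetGivenT q ch t) q ≤ ε) ∧
      condMI (P.joint q ch) rvA₁ rvB (pair rvA₂ rvT) ≥
        condMI (P.joint q ch) rvU₁ rvX₁ (pair rvU₂ (pair rvX₂ (pair rvW rvT))) ∧
      condMI (P.joint q ch) rvA₂ rvB (pair rvA₁ rvT) ≥
        condMI (P.joint q ch) rvU₂ rvX₂ (pair rvU₁ (pair rvX₁ (pair rvW rvT))) ∧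
      condMI (P.joint q ch) (pair rvA₁ rvA₂) rvB rvT ≥
        condMI (P.joint q ch) (pair rvU₁ rvU₂) (pair rvX₁ rvX₂) (pair rvW rvT) ∧
      R₀₁ + R₀₂ ≥
        condMI (P.joint q ch) (pair rvU₁ rvU₂) (pair rvX₁ (pair rvX₂ rvY)) (pair rvW rvT)
          - condEntropy (P.joint q ch) rvY (pair rvX₁ (pair rvX₂ (pair rvW rvT)))
          - condMI (P.joint q ch) (pair rvA₁ rvA₂) rvB (pair rvZ rvT)
          - 2 * slack 𝓩 q ε ∧
      R₀₁ ≥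
        condMI (P.joint q ch) rvU₁ (pair rvX₁ (pair rvX₂ rvY)) (pair rvW rvT)
          - condEntropy (P.joint q ch) rvY (pair rvX₁ (pair rvX₂ (pair rvW rvT)))
          - condMI (P.joint q ch) (pair rvA₁ rvA₂) rvB (pair rvZ rvT)
          - 2 * slack 𝓩 q ε ∧
      R₀₂ ≥
        condMI (P.joint q ch) rvU₂ (pair rvX₁ (pair rvX₂ rvY)) (pair rvW rvT)
          - condEntropy (P.joint q ch) rvY (pair rvX₁ (pair rvX₂ (pair rvW rvT)))
          - condMI (P.joint q ch) (pair rvA₁ rvA₂) rvB (pair rvZ rvT)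
          - 2 * slack 𝓩 q ε := by
  have hneQ := nonempty_of_mem_stdSimplex hq
  obtain ⟨⟨x₁, x₂, w, -⟩⟩ := id hneQ
  -- a code exists, and its encoders have rows of mass one, so no channel alphabet is empty
  have hneZ : Nonempty 𝓩 := by
    obtain ⟨R, h1, h2, c, -⟩ := closure_nonempty_iff.1 ⟨_, hR⟩
    obtain ⟨a₁⟩ := nonempty_of_mem_stdSimplex
      ((c 1).enc₁_mem (fun _ => x₁) ⟨0, numKeys_pos h1 1⟩)
    obtain ⟨a₂⟩ := nonempty_of_mem_stdSimplex
      ((c 1).enc₂_mem (fun _ => x₂) ⟨0, numKeys_pos h2 1⟩)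
    obtain ⟨-, z⟩ := nonempty_of_mem_stdSimplex (hch (a₁ 0, a₂ 0))
    exact ⟨z⟩
  have hs : 0 < slack 𝓩 q ε := slack_pos hq hε.1 (by linarith [hε.2]) hneQ
  set s := slack 𝓩 q ε
  obtain ⟨⟨R₁, R₂⟩, ⟨hR₁, hR₂, c, hc⟩, hdist⟩ := Metric.mem_closure_iff.1 hR (s / 2) (by positivity)
  rw [Prod.dist_eq, max_lt_iff, Real.dist_eq, Real.dist_eq, abs_lt, abs_lt] at hdist
  -- the error terms vanish with `δ`, so a small `δ` keeps them below the fixed slack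
  have hmod := ((tendsto_modulus (Fintype.card 𝓩 * Fintype.card (𝓧₁ × 𝓧₂ × 𝓦 × 𝓨))).add
    (tendsto_modulus (Fintype.card (𝓧₁ × 𝓧₂ × 𝓦 × 𝓨)))).eventually_le_const
      (u := s) (by simpa using hs)
  obtain ⟨δ, hδs, hδ, hδε⟩ := (hmod.and (Ioc_mem_nhdsGT hε.1)).exists
  obtain ⟨n, hnδ, hn⟩ := ((hc.eventually_le_const hδ).and (eventually_gt_atTop 0)).exists
  have hM₁ := numKeys_pos hR₁ n
  have hM₂ := numKeys_pos hR₂ n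
  have hp := (c n).pmf_mem hq hch hM₁ hM₂
  have hn0 : (0 : ℝ) < n := by exact_mod_cast hn
  have hK₁ : ent ((c n).pmf q ch) (fun ω => (spK ω).1) / n ≤ R₁ := by
    rw [div_le_iff₀' hn0]
    refine (ent_le_logb_card hp _).trans ?_
    rw [Fintype.card_fin]
    exact logb_numKeys_le hR₁ n
  have hK₂ : ent ((c n).pmf q ch) (fun ω => (spK ω).2) / n ≤ R₂ := by
    rw [div_le_iff₀' hn0]
    refine (ent_le_logb_card hp _).trans ?_
    rw [Fintype.card_fin]
    exact logb_numKeys_le hR₂ n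
  have hK : ent ((c n).pmf q ch) spK / n ≤ R₁ + R₂ := by
    refine le_trans ?_ (add_le_add hK₁ hK₂)
    rw [← add_div]
    exact div_le_div_of_nonneg_right (ent_pair_le hp (fun ω => (spK ω).1) fun ω => (spK ω).2) hn0.le
  obtain ⟨m₁, m₂, P, hP, h1, h2, h3, h4, h5, h6⟩ := Code.exists_auxiliary (x₁, x₂, w) (c n) hq hch hM₁
    hM₂ hn hδ (by linarith [hε.2]) hnδ hδε hδs
  exact ⟨n, m₁, m₂, P, hP, h1, h2, h3, by linarith, by linarith, by linarith⟩
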